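/- **Structures.** Let $\mathcal L$ be a set of predicate and function symbols with arities in $\mathbb N$. An $\mathcal L$-structure $\mathfrak A$ is a complete (possibly empty) metric space $A$ with continuous interpretations $R^{\mathfrak A}\colon A^n\to\mathbb R$ of the $n$-ary predicate symbols and $f^{\mathfrak A}\colon A^n\to A$ of the $n$-ary function symbols. Embeddings are maps preserving the distance, the predicates and the functions; $\langle S\rangle$ is the smallest substructure (closed subset closed under the functions) containing $S$. A finite partial isomorphism $f\colon\mathfrak A\dashrightarrow\mathfrak B$ is a map from a finite set $\operatorname{dom} f\subseteq A$ to $B$ which extends to an embedding $\langle \operatorname{dom} f\rangle\to\mathfrak B$. **Approximate isometries.** For metric spaces $X,Y$, $\mathrm{Apx}(X,Y)\subseteq[0,\infty]^{X\times Y}$ (product topology, pointwise order) is the set of all $\psi$ such that in each argument separately $\psi$ is Katětov, i.e. $\psi(x)\le d(x,x')+\psi(x')$ and $d(x,x')\le\psi(x)+\psi(x')$. Put $(\varphi\psi)(x,z)=\inf_y\psi(x,y)+\varphi(y,z)$ and $\psi^*(y,x)=\psi(x,y)$, and identify a partial isometry $f$ with $(x,y)\mapsto\inf_{z\in\operatorname{dom}f}d(x,z)+d(fz,y)$.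 Write $\varphi<\psi$ if $\varphi$ is in the interior of $\{\chi:\chi\le\psi\}$ in $\mathrm{Apx}(X,Y)$. For $r>0$, $\psi$ is $r$-total on $S\subseteq X$ if $\psi^*\psi\le d+2r$ on $S\times S$. **Fraïssé classes.** Let $\mathcal K$ be a class of finitely generated $\mathcal L$-structures. A $\mathcal K$-structure is a structure $\mathfrak A$ such that every finitely generated structure embeddable in $\mathfrak A$ is in $\mathcal K$. Let $\mathrm{Apx}_{\mathcal K}(\mathfrak A,\mathfrak B)$ be the closure in $\mathrm{Apx}(A,B)$ of the set of all $\psi$ with $\psi\ge fg$ for some $\mathfrak C\in\mathcal K$ and some finite partial isomorphisms $g\colon\mathfrak A\dashrightarrow\mathfrak C$, $f\colon\mathfrak C\dashrightarrow\mathfrak B$, and let $\mathrm{Stx}(\mathfrak A,\mathfrak B)$ be the set of $\psi\in\mathrm{Apx}_{\mathcal K}(\mathfrak A,\mathfrak B)$ such that $\varphi<\psi$ for some $\varphi\in\mathrm{Apx}_{\mathcal K}(\mathfrak A,\mathfrak B)$. Let $\mathcal K_n$ be the class of pairs $(\bar a,\mathfrak A)$ with $\mathfrak A\in\mathcal K$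 and $\bar a\in A^n$ generating $\mathfrak A=\langle\bar a\rangle$, with the pseudo-distance $d^{\mathcal K}(\bar a,\bar b)=\inf_\psi\max_{i}\psi(a_i,b_i)$, where $\psi$ ranges over those members of $\mathrm{Apx}_{\mathcal K}(\langle\bar a\rangle,\langle\bar b\rangle)$ which are trivial extensions of approximate isometries between the finite sets $\{a_i\}$ and $\{b_i\}$. Then $\mathcal K$ is a *Fraïssé class* if: - (HP) every member of $\mathcal K$ is a $\mathcal K$-structure; - (JEP) any two members of $\mathcal K$ embed in a third one; - (NAP) for all $\mathfrak A,\mathfrak B\in\mathcal K$, every finite partial isomorphism $f\colon\mathfrak A\dashrightarrow\mathfrak B$ and every $\varepsilon>0$ there are $\mathfrak C\in\mathcal K$ and embeddings $g\colon\mathfrak A\to\mathfrak C$, $h\colon\mathfrak B\to\mathfrak C$ with $d(ga,hfa)\le\varepsilon$ for all $a\in\operatorname{dom}f$; - (PP) $d^{\mathcal K}$ is separable and complete on $\mathcal K_n$ for each $n$; - (CP) $\mathcal K_n\to\mathbb R$, $\bar a\mapsto P^{\langle\bar a\rangle}(\bar a)$ is continuous for every $n$-ary predicate symbol $P$, and $\mathcal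 K_{n+m}\to\mathcal K_{n+m+1}$, $(\bar a,\bar b)\mapsto(\bar a,\bar b,f^{\langle\bar a,\bar b\rangle}(\bar a))$ is continuous for every $n$-ary function symbol $f$ and every $m$. A *limit* of $\mathcal K$ is a separable $\mathcal K$-structure $\mathfrak M$ such that for every $\mathcal K$-structure $\mathfrak A$, finite $A_0\subseteq A$, $\psi\in\mathrm{Stx}(\mathfrak A,\mathfrak M)$ and $\varepsilon>0$ there is $\varphi\in\mathrm{Stx}(\mathfrak A,\mathfrak M)$ with $\varphi<\psi$ which is $\varepsilon$-total on $A_0$. **Theorem.** Let $\mathcal K$ be a Fraïssé class. Let $\overline{\mathcal K}_n=\mathcal K_n/\ker d^{\mathcal K}$ with the quotient metric, and let $\overline{\mathcal K}_\omega=\varprojlim\overline{\mathcal K}_n$ be the inverse limit along the maps $[a_0,\dots,a_n]\mapsto[a_0,\dots,a_{n-1}]$, with the topology induced from $\prod_n\overline{\mathcal K}_n$. For every $\xi\in\overline{\mathcal K}_\omega$ there are a $\mathcal K$-structure $\mathfrak M^\xi$ and a sequence $(a^\xi_i)_{i\in\mathbb N}$ generating it such that $\xi_n=[a^\xi_0,\dots,a^\xi_{n-1}]$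 for all $n$, and this pair is determined by $\xi$ up to a unique isomorphism. Let $\Xi$ be the set of $\xi\in\overline{\mathcal K}_\omega$ for which $\mathfrak M^\xi$ is a limit of $\mathcal K$ and every tail of the sequence $(a^\xi_i)$ is dense in $\mathfrak M^\xi$. Then $\overline{\mathcal K}_\omega$ is a Polish space, and $\Xi$ is a dense $G_\delta$ subset of it. -/

import Mathlib

open Set Filter Topology
open scoped ENNReal

universe u v w

namespace MetricFraisse

/-! ### Approximate isometries -/

section Approximate

variable {X Y Z D : Type*}

/-- Katětov functions `X → [0, ∞]`. -/
def IsKatetov [MetricSpace X] (ψ : X → ℝ≥0∞) : Prop :=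
  ∀ x y, ψ x ≤ edist x y + ψ y ∧ edist x y ≤ ψ x + ψ y

/-- Bi-Katětov functions `X × Y → [0, ∞]` (in curried form). -/
def IsBiKatetov [MetricSpace X] [MetricSpace Y] (ψ : X → Y → ℝ≥0∞) : Prop :=
  (∀ x, IsKatetov fun y => ψ x y) ∧ ∀ y, IsKatetov fun x => ψ x y

/-- The space of approximate isometries from `X` to `Y`, with the topology induced from
`[0, ∞] ^ (X × Y)` and the pointwise order. -/
abbrev Apx (X Y : Type*) [MetricSpace X] [MetricSpace Y] : Type _ :=
  {ψ : X → Y → ℝ≥0∞ // IsBiKatetov ψ}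

/-- The composition `φ ψ`, where `ψ` is from `X` to `Y` and `φ` is from `Y` to `Z`. -/
noncomputable def comp (φ : Y → Z → ℝ≥0∞) (ψ : X → Y → ℝ≥0∞) : X → Z → ℝ≥0∞ :=
  fun x z => ⨅ y, ψ x y + φ y z

/-- The pseudo-inverse `ψ*`. -/
def pinv (ψ : X → Y → ℝ≥0∞) : Y → X → ℝ≥0∞ := fun y x => ψ x y

/-- The approximate isometry `(x, y) ↦ inf_{z ∈ dom f} d(x, z) + d(f z, y)` of a partial map `f`
from `X` to `Y`, whose domain is given by `i : D → X`. For a total map take `i = id`, for a map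
defined on a subset take `i = Subtype.val`. -/
noncomputable def ofPartial [MetricSpace X] [MetricSpace Y] (i : D → X) (f : D → Y) :
    X → Y → ℝ≥0∞ :=
  fun x y => ⨅ z, edist x (i z) + edist (f z) y

/-- The trivial extension `j ψ i*` to `X × Y` of `ψ : X₀ × Y₀ → [0, ∞]`, where `i` and `j` are the
inclusions of the subsets `X₀` of `X` and `Y₀` of `Y`. -/
noncomputable def trivialExtension [MetricSpace X] [MetricSpace Y] (X₀ : Set X) (Y₀ : Set Y)
    (ψ : X₀ → Y₀ → ℝ≥0∞) : X → Y → ℝ≥0∞ :=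
  comp (ofPartial (id : Y₀ → Y₀) (Subtype.val : Y₀ → Y))
    (comp ψ (pinv (ofPartial (id : X₀ → X₀) (Subtype.val : X₀ → X))))

/-- `φ < ψ`: the approximate isometry `φ` lies in the interior of `{χ | χ ≤ ψ}`. -/
def StrictlyRefines [MetricSpace X] [MetricSpace Y] (φ ψ : Apx X Y) : Prop :=
  φ ∈ interior {χ : Apx X Y | χ ≤ ψ}

/-- `𝒜↑`: the closure of `𝒜` under coarsening. -/
def coarsenings [MetricSpace X] [MetricSpace Y] (𝒜 : Set (Apx X Y)) : Set (Apx X Y) :=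
  {ψ | ∃ φ ∈ 𝒜, φ ≤ ψ}

/-- `ψ` is `r`-total on the subset `S` of `X`: the restriction `χ` of `ψ` to `S × Y` satisfies
`χ* χ ≤ id_S + 2 r`. -/
def IsTotalOn [MetricSpace X] (r : ℝ≥0∞) (S : Set X) (ψ : X → Y → ℝ≥0∞) : Prop :=
  ∀ x ∈ S, ∀ x' ∈ S, comp (pinv ψ) ψ x x' ≤ edist x x' + 2 * r

end Approximate

/-! ### Metric structures -/

/-- A metric structure in a language `L`: a (possibly empty) complete metric space with continuous
real-valued interpretations of the predicate symbols (`L.Relations n`) and continuous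
interpretations of the function symbols (`L.Functions n`). -/
structure MetricStructure (L : FirstOrder.Language.{u, v}) where
  carrier : Type w
  [metric : MetricSpace carrier]
  [complete : CompleteSpace carrier]
  pred : ∀ {n : ℕ}, L.Relations n → (Fin n → carrier) → ℝ
  continuous_pred : ∀ {n : ℕ} (R : L.Relations n), Continuous (pred R)
  func : ∀ {n : ℕ}, L.Functions n → (Fin n → carrier) → carrier
  continuous_func : ∀ {n : ℕ} (f : L.Functions n), Continuous (func f)

variable {L : FirstOrder.Language.{u, v}}

instance : CoeSort (MetricStructure.{u, v, w} L) (Type w) := ⟨MetricStructure.carrier⟩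

instance (A : MetricStructure.{u, v, w} L) : MetricSpace A := A.metric

instance (A : MetricStructure.{u, v, w} L) : CompleteSpace A := A.complete

/-- The underlying sets of substructures: the closed (equivalently, complete) subsets which are
closed under the function symbols. -/
def IsSubstructure (A : MetricStructure.{u, v, w} L) (T : Set A) : Prop :=
  IsClosed T ∧ ∀ (n : ℕ) (f : L.Functions n) (x : Fin n → A), (∀ i, x i ∈ T) → A.func f x ∈ T

/-- The underlying set of the smallest substructure of `A` containing `S`. -/
def genSet (A : MetricStructure.{u, v, w} L) (S : Set A) : Set A :=
  ⋂₀ {T | S ⊆ T ∧ IsSubstructure A T}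

theorem subset_genSet (A : MetricStructure.{u, v, w} L) (S : Set A) : S ⊆ genSet A S :=
  fun _ hx _ hT => hT.1 hx

theorem genSet_subset (A : MetricStructure.{u, v, w} L) {S T : Set A} (h : S ⊆ T)
    (hT : IsSubstructure A T) : genSet A S ⊆ T :=
  fun _ hx => hx T ⟨h, hT⟩

theorem genSet_mono (A : MetricStructure.{u, v, w} L) {S T : Set A} (h : S ⊆ T) :
    genSet A S ⊆ genSet A T :=
  fun _ hx U hU => hx U ⟨h.trans hU.1, hU.2⟩

theorem isSubstructure_genSet (A : MetricStructure.{u, v, w} L) (S : Set A) :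
    IsSubstructure A (genSet A S) :=
  ⟨isClosed_sInter fun _ hT => hT.2.1,
    fun n f x hx T hT => hT.2.2 n f x fun i => hx i T hT⟩

/-- The structure induced on a substructure. -/
def induced (A : MetricStructure.{u, v, w} L) (T : Set A) (hT : IsSubstructure A T) :
    MetricStructure.{u, v, w} L where
  carrier := T
  complete := hT.1.completeSpace_coe
  pred R x := A.pred R fun i => (x i : A)
  continuous_pred R := (A.continuous_pred R).comp (by fun_prop)
  func f x := ⟨A.func f fun i => (x i : A), hT.2 _ f _ fun i => (x i).2⟩
  continuous_func f := ((A.continuous_func f).comp (by fun_prop)).subtype_mk _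

/-- The substructure `⟨S⟩` of `A` generated by `S`. -/
def generated (A : MetricStructure.{u, v, w} L) (S : Set A) : MetricStructure.{u, v, w} L :=
  induced A (genSet A S) (isSubstructure_genSet A S)

/-- `A` is finitely generated. -/
def IsFinitelyGenerated (A : MetricStructure.{u, v, w} L) : Prop :=
  ∃ S : Set A, S.Finite ∧ genSet A S = univ

/-- Embeddings of structures: they preserve the distance, the predicates and the functions. -/
@[ext]
structure Embedding (A B : MetricStructure.{u, v, w} L) where
  toFun : A → B
  isometry' : Isometry toFun
  map_pred' : ∀ {n : ℕ} (R : L.Relations n) (x : Fin n → A),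
    B.pred R (fun i => toFun (x i)) = A.pred R x
  map_func' : ∀ {n : ℕ} (f : L.Functions n) (x : Fin n → A),
    B.func f (fun i => toFun (x i)) = toFun (A.func f x)

instance (A B : MetricStructure.{u, v, w} L) : CoeFun (Embedding A B) fun _ => A → B :=
  ⟨Embedding.toFun⟩

/-- The inclusion of a generated substructure. -/
def generatedInclusion (A : MetricStructure.{u, v, w} L) (S : Set A) :
    Embedding (generated A S) A where
  toFun := fun x : genSet A S => (x : A)
  isometry' := isometry_subtype_coe
  map_pred' _ _ := rfl
  map_func' _ _ := rfl

/-- Partial isomorphisms from `A` to `B` with finite domain: maps on a finite set `A₀ ⊆ A` which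
extend to an embedding of `⟨A₀⟩` in `B`. -/
structure FinitePartialIso (A B : MetricStructure.{u, v, w} L) where
  dom : Set A
  finite_dom : dom.Finite
  toFun : dom → B
  extends' : ∃ φ : Embedding (generated A dom) B,
    ∀ a : dom, φ (⟨a, subset_genSet A dom a.2⟩ : genSet A dom) = toFun a

/-- The approximate isometry associated to a finite partial isomorphism. -/
noncomputable def FinitePartialIso.toApx {A B : MetricStructure.{u, v, w} L}
    (f : FinitePartialIso A B) : A → B → ℝ≥0∞ :=
  ofPartial (Subtype.val : f.dom → A) f.toFun

/-- The age of `A`: the finitely generated structures which embed in `A`. -/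
def age (A : MetricStructure.{u, v, w} L) : Set (MetricStructure.{u, v, w} L) :=
  {B | IsFinitelyGenerated B ∧ Nonempty (Embedding B A)}

/-! ### Classes of finitely generated structures -/

variable (K : Set (MetricStructure.{u, v, w} L))

/-- `𝒦`-structures. -/
def IsStructureOf (A : MetricStructure.{u, v, w} L) : Prop := age A ⊆ K

/-- The hereditary property. -/
def HereditaryProperty : Prop := ∀ A ∈ K, IsStructureOf K A

/-- The joint embedding property. -/
def JointEmbeddingProperty : Prop :=
  ∀ A ∈ K, ∀ B ∈ K, ∃ C ∈ K, Nonempty (Embedding A C) ∧ Nonempty (Embedding B C)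

/-- The near amalgamation property. -/
def NearAmalgamationProperty : Prop :=
  ∀ A ∈ K, ∀ B ∈ K, ∀ (f : FinitePartialIso A B) (ε : ℝ), 0 < ε →
    ∃ C ∈ K, ∃ (g : Embedding A C) (h : Embedding B C),
      ∀ a : f.dom, dist (g a) (h (f.toFun a)) ≤ ε

/-- `Apx₂(A, B)`: compositions of two finite partial isomorphisms through a member of `𝒦`. -/
def apxTwo (A B : MetricStructure.{u, v, w} L) : Set (Apx A B) :=
  {ψ | ∃ C ∈ K, ∃ (g : FinitePartialIso A C) (f : FinitePartialIso C B),
    ψ.1 = comp f.toApx g.toApx}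

/-- The set of (`𝒦`-intrinsic) approximate isomorphisms from `A` to `B`. -/
def apxIso (A B : MetricStructure.{u, v, w} L) : Set (Apx A B) :=
  closure (coarsenings (apxTwo K A B))

/-- The set `Stx(A, B)` of strictly approximate isomorphisms from `A` to `B`. -/
def stx (A B : MetricStructure.{u, v, w} L) : Set (Apx A B) :=
  {ψ | ψ ∈ apxIso K A B ∧ ∃ φ ∈ apxIso K A B, StrictlyRefines φ ψ}

/-- `𝒦ₙ`: pairs `(a, A)` with `A ∈ 𝒦` and `a ∈ Aⁿ` generating `A`. -/
structure Pointed (n : ℕ) where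
  str : MetricStructure.{u, v, w} L
  mem : str ∈ K
  tuple : Fin n → str
  generates : genSet str (range tuple) = univ

variable {K}

/-- `Apx(a, b)` for `a, b ∈ 𝒦ₙ`: those approximate isomorphisms from `⟨a⟩` to `⟨b⟩` which extend
trivially from an approximate isometry between the finite sets `a` and `b`. -/
def apxTuple {n : ℕ} (p q : Pointed K n) : Set (Apx p.str q.str) :=
  {ψ | ψ ∈ apxIso K p.str q.str ∧
    ∃ ψ₀ : Apx (range p.tuple) (range q.tuple),
      ψ.1 = trivialExtension (range p.tuple) (range q.tuple) ψ₀.1}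

/-- The pseudo-distance `d^𝒦` on `𝒦ₙ`. -/
noncomputable def distK {n : ℕ} (p q : Pointed K n) : ℝ≥0∞ :=
  ⨅ ψ ∈ apxTuple p q, ⨆ i, ψ.1 (p.tuple i) (q.tuple i)

/-- The topology of the pseudo-distance `d^𝒦`. -/
instance (n : ℕ) : TopologicalSpace (Pointed K n) where
  IsOpen U := ∀ p ∈ U, ∃ ε : ℝ≥0∞, 0 < ε ∧ ∀ q, distK p q < ε → q ∈ U
  isOpen_univ := fun _ _ => ⟨1, one_pos, fun _ _ => trivial⟩
  isOpen_inter := by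
    intro U V hU hV p hp
    obtain ⟨ε, hε, h⟩ := hU p hp.1
    obtain ⟨δ, hδ, h'⟩ := hV p hp.2
    exact ⟨min ε δ, lt_min hε hδ, fun q hq =>
      ⟨h q (hq.trans_le (min_le_left _ _)), h' q (hq.trans_le (min_le_right _ _))⟩⟩
  isOpen_sUnion := by
    intro 𝒰 h𝒰 p ⟨U, hU, hp⟩
    obtain ⟨ε, hε, h⟩ := h𝒰 U hU p hp
    exact ⟨ε, hε, fun q hq => ⟨U, hU, h q hq⟩⟩

/-- `(c₀, …, cₙ₋₁, cₙ, …, cₙ₊ₘ₋₁) ↦ (c₀, …, cₙ₊ₘ₋₁, f(c₀, …, cₙ₋₁))`, as a map from `𝒦ₙ₊ₘ` to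
`𝒦ₙ₊ₘ₊₁`. -/
def Pointed.snocFunc {n m : ℕ} (f : L.Functions n) (p : Pointed K (n + m)) :
    Pointed K (n + m + 1) where
  str := p.str
  mem := p.mem
  tuple := Fin.snoc (α := fun _ => p.str) p.tuple
    (p.str.func f fun i => p.tuple (Fin.castAdd m i))
  generates := by
    refine univ_subset_iff.1 (p.generates ▸ genSet_mono p.str ?_)
    rintro _ ⟨i, rfl⟩
    exact ⟨i.castSucc, by simp⟩

/-- The element `(a, ⟨a⟩)` of `𝒦ₙ` given by a tuple `a` in a `𝒦`-structure `A`. -/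
def Pointed.ofTuple {A : MetricStructure.{u, v, w} L} (hA : IsStructureOf K A) {n : ℕ}
    (a : Fin n → A) : Pointed K n :=
  have key : genSet (generated A (range a))
      (range fun i => (⟨a i, subset_genSet A _ ⟨i, rfl⟩⟩ : genSet A (range a))) = univ := by
    refine eq_univ_of_forall fun x T hT => ?_
    have hsub : genSet A (range a) ⊆ Subtype.val '' (T : Set (genSet A (range a))) := by
      refine genSet_subset A ?_ ⟨?_, ?_⟩
      · rintro _ ⟨i, rfl⟩
        exact ⟨_, hT.1 ⟨i, rfl⟩, rfl⟩
      · exact (isSubstructure_genSet A (range a)).1.isClosedMap_subtype_val _ hT.2.1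
      · intro n f y hy
        choose z hz hzy using hy
        refine ⟨_, hT.2.2 n f z hz, ?_⟩
        exact congrArg (A.func f) (funext hzy)
    obtain ⟨y, hy, hyx⟩ := hsub (x : genSet A (range a)).2
    exact (Subtype.ext hyx : y = x) ▸ hy
  { str := generated A (range a)
    mem := hA ⟨⟨_, finite_range _, key⟩, ⟨generatedInclusion A (range a)⟩⟩
    tuple := fun i => (⟨a i, subset_genSet A _ ⟨i, rfl⟩⟩ : genSet A (range a))
    generates := key }

variable (K)

/-- Metric Fraïssé classes. -/
structure IsFraisseClass : Prop where
  finitelyGenerated : ∀ A ∈ K, IsFinitelyGenerated A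
  hereditary : HereditaryProperty K
  jointEmbedding : JointEmbeddingProperty K
  nearAmalgamation : NearAmalgamationProperty K
  /-- The Polish property: `𝒦ₙ` is separable and complete for the pseudo-distance `d^𝒦`. -/
  separable : ∀ n, ∃ S : Set (Pointed K n), S.Countable ∧
    ∀ (p : Pointed K n) (ε : ℝ≥0∞), 0 < ε → ∃ q ∈ S, distK p q < ε
  complete : ∀ (n : ℕ) (p : ℕ → Pointed K n),
    (∀ ε : ℝ≥0∞, 0 < ε → ∃ N, ∀ i ≥ N, ∀ j ≥ N, distK (p i) (p j) < ε) →
      ∃ q, Tendsto (fun i => distK (p i) q) atTop (𝓝 0)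
  /-- The continuity property. -/
  continuous_pred : ∀ (n : ℕ) (R : L.Relations n),
    Continuous fun p : Pointed K n => p.str.pred R p.tuple
  continuous_func : ∀ (n : ℕ) (f : L.Functions n) (m : ℕ),
    Continuous fun p : Pointed K (n + m) => p.snocFunc f

/-- `M` is a limit of the class `𝒦`. -/
def IsLimit (M : MetricStructure.{u, v, w} L) : Prop :=
  TopologicalSpace.SeparableSpace M ∧ IsStructureOf K M ∧
    ∀ A : MetricStructure.{u, v, w} L, IsStructureOf K A → ∀ A₀ : Set A, A₀.Finite →
      ∀ ψ ∈ stx K A M, ∀ ε : ℝ, 0 < ε →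
        ∃ φ ∈ stx K A M, StrictlyRefines φ ψ ∧ IsTotalOn (ENNReal.ofReal ε) A₀ φ.1

/-! ### The inverse limit -/

/-- The quotient `𝒦ₙ / ker d^𝒦`, with the quotient topology (which is the topology of the quotient
metric). -/
abbrev PointedQuot (n : ℕ) : Type _ := Quot fun p q : Pointed K n => distK p q = 0

variable {K}

/-- The class `[p]` of `p` modulo `ker d^𝒦`. -/
def Pointed.toQuot {n : ℕ} (p : Pointed K n) : PointedQuot K n := Quot.mk _ p

/-- `(a₀, …, aₙ) ↦ (a₀, …, aₙ₋₁)`, as a map from `𝒦ₙ₊₁` to `𝒦ₙ`. -/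
def Pointed.init (hK : HereditaryProperty K) {n : ℕ} (p : Pointed K (n + 1)) : Pointed K n :=
  Pointed.ofTuple (hK p.str p.mem) fun i : Fin n => p.tuple i.castSucc

/-- The inverse limit of the spaces `𝒦ₙ / ker d^𝒦` along the maps
`[a₀, …, aₙ] ↦ [a₀, …, aₙ₋₁]`, with the topology induced from the product. The compatibility
condition says that `(ξₙ₊₁, ξₙ)` is in the graph of this map. -/
abbrev InverseLimit (hK : HereditaryProperty K) : Type _ :=
  {ξ : ∀ n, PointedQuot K n //
    ∀ n, ∃ p : Pointed K (n + 1), p.toQuot = ξ (n + 1) ∧ (p.init hK).toQuot = ξ n}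

/-- `M` with the sequence `a` is a structure coded by `ξ`: `M` is a `𝒦`-structure generated by `a`,
and `ξₙ = [a₀, …, aₙ₋₁]` for all `n`. -/
def IsCodedBy {hK : HereditaryProperty K} (ξ : InverseLimit hK) (M : MetricStructure.{u, v, w} L)
    (a : ℕ → M) : Prop :=
  ∃ hM : IsStructureOf K M, genSet M (range a) = univ ∧
    ∀ n, ξ.1 n = (Pointed.ofTuple hM fun i : Fin n => a i).toQuot

/-- The set of those codes `ξ` for which the structure coded by `ξ` is a limit of `𝒦`, and every
tail of the generating sequence is dense in it. -/
def limitCodes (hK : HereditaryProperty K) : Set (InverseLimit hK) :=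
  {ξ | ∃ (M : MetricStructure.{u, v, w} L) (a : ℕ → M),
    IsCodedBy ξ M a ∧ IsLimit K M ∧ ∀ m, Dense (a '' Ici m)}

end MetricFraisse

/-!
The proof replaces approximate isometries by amalgams of finite tuples. Two tuples, in possibly
different structures, have the same quantifier-free type (`SameType`) if terms evaluated at them
have the same distances and predicate values; then mapping one to the other extends to an
isomorphism of the generated substructures (`SameType.exists_embedding`). Two tuples are `r`-near
(`Near`) if they have copies in a member of the class at pointwise distance less than `r`. By near
amalgamation, this is the relation `d^𝒦 < r` (`distK_lt_iff`), and an approximate isomorphism is,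
up to `ε` and on finite tuples, the distance between copies in a member of the class
(`exists_amalgam_of_mem_apxIso`, `amalgamApx_mem_apxIso`).

The continuity property says that at a given type of tuples a function symbol or a predicate is
continuous uniformly over all structures of the class (`IsFraisseClass.exists_dist_func_lt`), hence
so are terms. It follows that types pass to limits (`SameType.of_near`), so that `d^𝒦` vanishes
exactly on pairs of the same type, and the inverse limit is a closed subspace of a product of Polish
spaces.

The structure coded by `ξ` is the completion of the union of the chain of the structures `ξₙ`. The
function symbols need not be uniformly continuous, but they extend to the completion: by
completeness of `𝒦ₘ` the type of an `m`-tuple of the completion is realized in the class, and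
uniform continuity at this type makes the symbol preserve Cauchy filters there
(`exists_structure_of_chain`). For the same reason the completion is a `𝒦`-structure. Uniqueness
holds because a code determines the type of the generating sequence.

A separable `𝒦`-structure is a limit if and only if it has the extension property: every type of
`(n + 1)`-tuples which is near `c` on its first `n` coordinates is realized, equally near, by some
`(c, d)` (`IsLimit.extensionProperty`, `ExtensionProperty.isLimit`). Finally, `ξ` is the code of a
limit enumerated with dense tails if and only if the extension property holds for the tuples
extracted from the sequence, for types in a countable dense set and rational bounds, with witnesses
in every tail (`limitCodes_eq_iInter`); the density of the tails comes from the continuity property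
(`dense_image_Ici`). Each of these countably many conditions defines the union of a closed and an
open set, which is dense by amalgamation (`dense_extensionCodes`), and the Baire category theorem
applies.
-/

namespace MetricFraisse

variable {L : FirstOrder.Language.{u, v}}

/-! ### Quantifier-free types of tuples -/

/-- The value of a term at a tuple. -/
def realize {A : MetricStructure.{u, v, w} L} {ι : Type} (a : ι → A) : L.Term ι → A
  | .var i => a i
  | .func f ts => A.func f fun j => realize a (ts j)

/-- Two tuples, possibly in different structures, have the same quantifier-free type: the terms
evaluated at them have the same distances and the same values of predicates. Equivalently
(`SameType.exists_embedding`), mapping one tuple to the other extends to an isomorphism of the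
generated substructures. -/
structure SameType {A B : MetricStructure.{u, v, w} L} {ι : Type} (a : ι → A) (b : ι → B) :
    Prop where
  dist_realize : ∀ s t : L.Term ι,
    dist (realize a s) (realize a t) = dist (realize b s) (realize b t)
  pred_realize : ∀ {n : ℕ} (R : L.Relations n) (ts : Fin n → L.Term ι),
    A.pred R (fun j => realize a (ts j)) = B.pred R fun j => realize b (ts j)

section SameType

variable {A B C : MetricStructure.{u, v, w} L} {ι κ : Type}

theorem realize_subst (a : ι → A) (ts : κ → L.Term ι) (t : L.Term κ) :
    realize a (t.subst ts) = realize (fun k => realize a (ts k)) t := by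
  induction t with
  | var i => rfl
  | func f us ih => exact congrArg (A.func f) (funext ih)

theorem realize_embedding (φ : Embedding A B) (a : ι → A) (t : L.Term ι) :
    realize (fun i => φ (a i)) t = φ (realize a t) := by
  induction t with
  | var i => rfl
  | func f us ih => exact (congrArg (B.func f) (funext ih)).trans (φ.map_func' f _)

theorem continuous_realize (A : MetricStructure.{u, v, w} L) (t : L.Term ι) :
    Continuous fun a : ι → A => realize a t := by
  induction t with
  | var i => exact continuous_apply i
  | func f us ih => exact (A.continuous_func f).comp (continuous_pi ih)

namespace SameType

theorem refl (a : ι → A) : SameType a a := ⟨fun _ _ => rfl, fun _ _ => rfl⟩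

theorem symm {a : ι → A} {b : ι → B} (h : SameType a b) : SameType b a :=
  ⟨fun s t => (h.1 s t).symm, fun R ts => (h.2 R ts).symm⟩

theorem trans {a : ι → A} {b : ι → B} {c : ι → C} (h : SameType a b) (h' : SameType b c) :
    SameType a c :=
  ⟨fun s t => (h.1 s t).trans (h'.1 s t), fun R ts => (h.2 R ts).trans (h'.2 R ts)⟩

theorem of_embedding (φ : Embedding A B) (a : ι → A) : SameType a fun i => φ (a i) :=
  ⟨fun s t => by rw [realize_embedding, realize_embedding, φ.isometry'.dist_eq],
    fun R ts => by simp only [realize_embedding, φ.map_pred']⟩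

theorem realize {a : ι → A} {b : ι → B} (h : SameType a b) (ts : κ → L.Term ι) :
    SameType (fun k => realize a (ts k)) fun k => MetricFraisse.realize b (ts k) :=
  ⟨fun s t => by simpa only [realize_subst] using h.1 (s.subst ts) (t.subst ts),
    fun R us => by simpa only [realize_subst] using h.2 R fun j => (us j).subst ts⟩

theorem comp {a : ι → A} {b : ι → B} (h : SameType a b) (σ : κ → ι) :
    SameType (fun k => a (σ k)) fun k => b (σ k) :=
  h.realize fun k => .var (σ k)

theorem dist_eq {a : ι → A} {b : ι → B} (h : SameType a b) (i j : ι) :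
    dist (a i) (a j) = dist (b i) (b j) := h.1 (.var i) (.var j)

theorem pred_eq {a : ι → A} {b : ι → B} (h : SameType a b) {n : ℕ} (R : L.Relations n)
    (σ : Fin n → ι) : A.pred R (fun j => a (σ j)) = B.pred R fun j => b (σ j) :=
  h.2 R fun j => .var (σ j)

end SameType

theorem exists_term_fin (t : L.Term ℕ) :
    ∃ N, ∀ n ≥ N, ∃ t' : L.Term (Fin n), ∀ (A : MetricStructure.{u, v, w} L) (a : ℕ → A),
      realize a t = realize (fun i : Fin n => a i) t' := by
  induction t with
  | var i => exact ⟨i + 1, fun n hn => ⟨.var ⟨i, hn⟩, fun _ _ => rfl⟩⟩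
  | func f us ih =>
    choose N hN using ih
    refine ⟨Finset.univ.sup N, fun n hn => ?_⟩
    choose t' ht' using fun j => hN j n ((Finset.le_sup (Finset.mem_univ j)).trans hn)
    exact ⟨.func f t', fun A a => congrArg (A.func f) (funext fun j => ht' j A a)⟩

/-- The type of a sequence is determined by the types of its initial segments. -/
theorem SameType.of_forall_fin {a : ℕ → A} {b : ℕ → B}
    (h : ∀ n, SameType (fun i : Fin n => a i) fun i : Fin n => b i) : SameType a b := by
  constructor
  · intro s t
    obtain ⟨N, hN⟩ := exists_term_fin.{u, v, w} s
    obtain ⟨N', hN'⟩ := exists_term_fin.{u, v, w} t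
    obtain ⟨s', hs⟩ := hN (max N N') (le_max_left _ _)
    obtain ⟨t', ht⟩ := hN' (max N N') (le_max_right _ _)
    rw [hs, ht, hs, ht]
    exact (h _).1 s' t'
  · intro n R ts
    choose N hN using fun j => exists_term_fin.{u, v, w} (ts j)
    choose t' ht' using fun j => hN j (Finset.univ.sup N) (Finset.le_sup (Finset.mem_univ j))
    simp only [ht']
    exact (h _).2 R t'

/-! ### Extension of maps and generated substructures -/

/-- A map defined on a dense family, with values in a complete space, extends continuously as soon
as its oscillation at every point of the larger space vanishes; uniform continuity is not needed. -/
theorem exists_continuous_extension {S X Y : Type*} [MetricSpace X] [MetricSpace Y]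
    [CompleteSpace Y] {i : S → X} (hi : DenseRange i) (g : S → Y)
    (hg : ∀ x, ∀ ε > 0, ∃ δ > 0, ∀ s s', dist (i s) x < δ → dist (i s') x < δ →
      dist (g s) (g s') < ε) :
    ∃ F : X → Y, Continuous F ∧ ∀ s, F (i s) = g s := by
  let _ : TopologicalSpace S := TopologicalSpace.induced i inferInstance
  have di : IsDenseInducing i := ⟨⟨rfl⟩, hi⟩
  have key : ∀ x, ∃ c, Tendsto g (comap i (𝓝 x)) (𝓝 c) := by
    intro x
    have := di.comap_nhds_neBot x
    have hc : Cauchy (map g (comap i (𝓝 x))) := by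
      refine Metric.cauchy_iff.2 ⟨inferInstance, fun ε hε => ?_⟩
      obtain ⟨δ, hδ, h⟩ := hg x ε hε
      refine ⟨g '' (i ⁻¹' Metric.ball x δ),
        image_mem_map (preimage_mem_comap (Metric.ball_mem_nhds x hδ)), ?_⟩
      rintro _ ⟨s, hs, rfl⟩ _ ⟨s', hs', rfl⟩
      exact h s s' hs hs'
    exact CompleteSpace.complete hc
  refine ⟨di.extend g, di.continuous_extend key, fun s => ?_⟩
  obtain ⟨c, hc⟩ := key (i s)
  rw [di.extend_eq_of_tendsto hc]
  refine tendsto_nhds_unique (hc.mono_left ?_) (tendsto_pure_nhds g s)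
  rw [← map_le_iff_le_comap, map_pure]
  exact pure_le_nhds _

theorem isSubstructure_closure_range_realize (a : ι → A) :
    IsSubstructure A (closure (range (realize a))) := by
  refine ⟨isClosed_closure, fun n f x hx => ?_⟩
  have h1 : x ∈ closure (univ.pi fun _ : Fin n => range (realize a)) := by
    rw [closure_pi_set]
    exact fun i _ => hx i
  refine map_mem_closure (A.continuous_func f) h1 fun y hy => ?_
  choose t ht using fun i => hy i (mem_univ i)
  exact ⟨.func f t, congrArg (A.func f) (funext ht)⟩

theorem genSet_range_subset_closure (a : ι → A) :
    genSet A (range a) ⊆ closure (range (realize a)) :=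
  genSet_subset A (by rintro _ ⟨i, rfl⟩; exact subset_closure ⟨.var i, rfl⟩)
    (isSubstructure_closure_range_realize a)

theorem denseRange_realize {a : ι → A} (ha : genSet A (range a) = univ) :
    DenseRange (realize a) :=
  fun x => genSet_range_subset_closure a (ha ▸ mem_univ x)

/-- A generating tuple is mapped to any tuple of the same type by an embedding. -/
theorem SameType.exists_embedding {a : ι → A} {b : ι → B} (h : SameType a b)
    (ha : genSet A (range a) = univ) : ∃ φ : Embedding A B, ∀ i, φ (a i) = b i := by
  have hd := denseRange_realize ha
  obtain ⟨F, hF, hFb⟩ := exists_continuous_extension hd (MetricFraisse.realize b)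
    fun x ε hε => ⟨ε / 2, half_pos hε, fun s t hs ht => by
      rw [← h.1]
      linarith [dist_triangle_right (MetricFraisse.realize a s) (MetricFraisse.realize a t) x]⟩
  have hdn : ∀ n, DenseRange fun (ts : Fin n → L.Term ι) j => MetricFraisse.realize a (ts j) :=
    fun n => DenseRange.piMap fun _ => hd
  refine ⟨⟨F, Isometry.of_dist_eq fun x y => ?_, fun {n} R x => ?_, fun {n} f x => ?_⟩,
    fun i => hFb (.var i)⟩
  · refine hd.induction_on₂ (p := fun x y => dist (F x) (F y) = dist x y)
      (isClosed_eq (by fun_prop) (by fun_prop)) (fun s t => ?_) x y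
    rw [hFb, hFb, h.1]
  · refine (hdn n).induction_on x
      (isClosed_eq ((B.continuous_pred R).comp (by fun_prop)) (A.continuous_pred R))
      fun ts => ?_
    simp only [hFb, h.2]
  · refine (hdn n).induction_on x
      (isClosed_eq ((B.continuous_func f).comp (by fun_prop))
        (hF.comp (A.continuous_func f))) fun ts => ?_
    simp only [hFb]
    exact (hFb (.func f ts)).symm

theorem Embedding.eqOn_genSet {φ ψ : Embedding A B} {S : Set A} (h : ∀ x ∈ S, φ x = ψ x) {x : A}
    (hx : x ∈ genSet A S) : φ x = ψ x :=
  genSet_subset A (T := {x | φ x = ψ x}) h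
    ⟨isClosed_eq φ.isometry'.continuous ψ.isometry'.continuous, fun n f y hy => by
      change φ _ = ψ _
      rw [← φ.map_func', ← ψ.map_func']
      exact congrArg _ (funext hy)⟩ hx

theorem isSubstructure_preimage (φ : Embedding A B) {T : Set B} (hT : IsSubstructure B T) :
    IsSubstructure A (φ ⁻¹' T) :=
  ⟨hT.1.preimage φ.isometry'.continuous, fun n f x hx => by
    rw [mem_preimage, ← φ.map_func']
    exact hT.2 n f _ hx⟩

theorem Embedding.map_mem_genSet (φ : Embedding A B) {S : Set A} {T : Set B}
    (h : ∀ x ∈ S, φ x ∈ genSet B T) {x : A} (hx : x ∈ genSet A S) : φ x ∈ genSet B T :=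
  genSet_subset A (T := φ ⁻¹' genSet B T) h
    (isSubstructure_preimage φ (isSubstructure_genSet B T)) hx

theorem isSubstructure_range (φ : Embedding A B) : IsSubstructure B (range φ) := by
  refine ⟨φ.isometry'.isClosedEmbedding.isClosed_range, fun n f x hx => ?_⟩
  choose y hy using hx
  exact ⟨A.func f y, by rw [← φ.map_func']; exact congrArg _ (funext hy)⟩

/-- An embedding whose range contains a generating set is onto. -/
theorem Embedding.surjective_of_range {φ : Embedding A B} {b : ι → B}
    (hb : genSet B (range b) = univ) (h : ∀ i, b i ∈ range φ) : Function.Surjective φ :=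
  fun x => genSet_subset B (by rintro _ ⟨i, rfl⟩; exact h i) (isSubstructure_range φ)
    (hb ▸ mem_univ x)

/-- The composition of embeddings. -/
def Embedding.comp (ψ : Embedding B C) (φ : Embedding A B) : Embedding A C where
  toFun x := ψ (φ x)
  isometry' := ψ.isometry'.comp φ.isometry'
  map_pred' R x := (ψ.map_pred' R _).trans (φ.map_pred' R x)
  map_func' f x := (ψ.map_func' f _).trans (congrArg ψ (φ.map_func' f x))

/-- A tuple in `A`, as a tuple in the substructure which it generates. -/
def genTuple (a : ι → A) : ι → generated A (range a) :=
  fun i => (⟨a i, subset_genSet A _ ⟨i, rfl⟩⟩ : genSet A (range a))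

theorem sameType_genTuple (a : ι → A) : SameType (genTuple a) a :=
  SameType.of_embedding (generatedInclusion A (range a)) (genTuple a)

theorem genSet_genTuple (a : ι → A) :
    genSet (generated A (range a)) (range (genTuple a)) = univ := by
  refine eq_univ_of_forall fun x => ?_
  -- the image in `A` of a substructure of `⟨a⟩` is a substructure of `A`
  have hS : IsSubstructure A (Subtype.val ''
      (genSet (generated A (range a)) (range (genTuple a)) : Set (genSet A (range a)))) := by
    have h := isSubstructure_genSet (generated A (range a)) (range (genTuple a))
    refine ⟨(isSubstructure_genSet A (range a)).1.isClosedMap_subtype_val _ h.1, ?_⟩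
    intro n f y hy
    choose z hz hzy using hy
    exact ⟨_, h.2 n f z hz, congrArg (A.func f) (funext hzy)⟩
  obtain ⟨y, hy, hyx⟩ := genSet_subset A (by
    rintro _ ⟨i, rfl⟩
    exact ⟨genTuple a i, subset_genSet _ _ ⟨i, rfl⟩, rfl⟩) hS (x : genSet A (range a)).2
  exact (Subtype.ext hyx : y = x) ▸ hy

/-- Mapping a finite tuple to one of the same type is a finite partial isomorphism. -/
theorem SameType.exists_partialIso [Finite ι] {a : ι → A} {b : ι → B} (h : SameType a b) :
    ∃ (f : FinitePartialIso A B) (e : ι → f.dom), Function.Surjective e ∧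
      ∀ i, (e i : A) = a i ∧ f.toFun (e i) = b i := by
  obtain ⟨φ, hφ⟩ := ((sameType_genTuple a).trans h).exists_embedding (genSet_genTuple a)
  refine ⟨⟨range a, finite_range a, fun x => φ (⟨x, subset_genSet A _ x.2⟩ : genSet A (range a)),
    φ, fun _ => rfl⟩, fun i => ⟨a i, i, rfl⟩, ?_, fun i => ⟨rfl, hφ i⟩⟩
  rintro ⟨_, i, rfl⟩
  exact ⟨i, rfl⟩

theorem FinitePartialIso.sameType (f : FinitePartialIso A B) {σ : ι → f.dom} :
    SameType (fun i => (σ i : A)) fun i => f.toFun (σ i) := by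
  obtain ⟨φ, hφ⟩ := f.extends'
  let c : ι → generated A f.dom :=
    fun i => (⟨σ i, subset_genSet A _ (σ i).2⟩ : genSet A f.dom)
  have h := (SameType.of_embedding (generatedInclusion A f.dom) c).symm.trans
    (SameType.of_embedding φ c)
  have hc : (fun i => φ (c i)) = fun i => f.toFun (σ i) := funext fun i => hφ (σ i)
  rw [hc] at h
  exact h

end SameType

/-! ### Amalgamation of finite tuples -/

/-- The tuples `a` and `b` have copies in a member of `K` which are pointwise at distance less than
`r`. For `r > 0` this says that the distance `d^K` is less than `r` (`distK_lt_iff`). -/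
def Near (K : Set (MetricStructure.{u, v, w} L)) {A B : MetricStructure.{u, v, w} L} {ι : Type}
    (r : ℝ) (a : ι → A) (b : ι → B) : Prop :=
  ∃ C ∈ K, ∃ a' b' : ι → C, SameType a a' ∧ SameType b b' ∧ ∀ i, dist (a' i) (b' i) < r

theorem exists_lt_forall_lt {ι : Type*} [Finite ι] {f : ι → ℝ} {r : ℝ} (h : ∀ i, f i < r) :
    ∃ s < r, ∀ i, f i < s := by
  have h1 : ∀ᶠ s in 𝓝[<] r, ∀ i, f i < s :=
    eventually_all.2 fun i => mem_of_superset (Ioo_mem_nhdsLT (h i)) fun s hs => hs.1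
  obtain ⟨s, h2, h3⟩ := (h1.and self_mem_nhdsWithin).exists
  exact ⟨s, h3, h2⟩

section Near

variable {K : Set (MetricStructure.{u, v, w} L)} {A B C D : MetricStructure.{u, v, w} L}
  {ι κ : Type} {r s : ℝ}

theorem IsStructureOf.generated_mem [Finite ι] (hA : IsStructureOf K A) (a : ι → A) :
    generated A (range a) ∈ K :=
  hA ⟨⟨_, finite_range _, genSet_genTuple a⟩, ⟨generatedInclusion A (range a)⟩⟩

theorem IsStructureOf.of_embedding (hB : IsStructureOf K B) (φ : Embedding A B) :
    IsStructureOf K A :=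
  fun _ hC => hB ⟨hC.1, hC.2.map φ.comp⟩

namespace Near

theorem symm {a : ι → A} {b : ι → B} (h : Near K r a b) : Near K r b a := by
  obtain ⟨C, hC, a', b', ha, hb, hd⟩ := h
  exact ⟨C, hC, b', a', hb, ha, fun i => by rw [dist_comm]; exact hd i⟩

theorem mono {a : ι → A} {b : ι → B} (h : Near K r a b) (hrs : r ≤ s) : Near K s a b := by
  obtain ⟨C, hC, a', b', ha, hb, hd⟩ := h
  exact ⟨C, hC, a', b', ha, hb, fun i => (hd i).trans_le hrs⟩

theorem congr {a : ι → A} {b : ι → B} {c : ι → C} {d : ι → D} (h : Near K r a b)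
    (hac : SameType a c) (hbd : SameType b d) : Near K r c d := by
  obtain ⟨C, hC, a', b', ha, hb, hd⟩ := h
  exact ⟨C, hC, a', b', hac.symm.trans ha, hbd.symm.trans hb, hd⟩

theorem comp {a : ι → A} {b : ι → B} (h : Near K r a b) (σ : κ → ι) :
    Near K r (fun k => a (σ k)) fun k => b (σ k) := by
  obtain ⟨C, hC, a', b', ha, hb, hd⟩ := h
  exact ⟨C, hC, _, _, ha.comp σ, hb.comp σ, fun i => hd (σ i)⟩

theorem of_dist_lt [Finite ι] (hA : IsStructureOf K A) {a b : ι → A}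
    (h : ∀ i, dist (a i) (b i) < r) : Near K r a b :=
  let c : ι ⊕ ι → A := Sum.elim a b
  ⟨_, hA.generated_mem c, fun i => genTuple c (.inl i), fun i => genTuple c (.inr i),
    (sameType_genTuple c).symm.comp Sum.inl, (sameType_genTuple c).symm.comp Sum.inr, h⟩

theorem of_sameType [Finite ι] (hA : IsStructureOf K A) {a : ι → A} {b : ι → B}
    (h : SameType a b) (hr : 0 < r) : Near K r a b :=
  (of_dist_lt hA fun i => (dist_self (a i)).trans_lt hr).congr (.refl a) h

theorem exists_lt [Finite ι] {a : ι → A} {b : ι → B} (h : Near K r a b) :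
    ∃ s < r, Near K s a b := by
  obtain ⟨C, hC, a', b', ha, hb, hd⟩ := h
  obtain ⟨s, hs, hd⟩ := exists_lt_forall_lt hd
  exact ⟨s, hs, C, hC, a', b', ha, hb, hd⟩

end Near

theorem IsFraisseClass.amalgamate [Finite ι] (hK : IsFraisseClass K) (hA : A ∈ K) (hB : B ∈ K)
    {a : ι → A} {b : ι → B} (h : SameType a b) {ε : ℝ} (hε : 0 < ε) :
    ∃ C ∈ K, ∃ (g : Embedding A C) (h : Embedding B C), ∀ i, dist (g (a i)) (h (b i)) ≤ ε := by
  obtain ⟨f, e, -, he⟩ := h.exists_partialIso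
  obtain ⟨C, hC, g, h, hd⟩ := hK.nearAmalgamation A hA B hB f ε hε
  exact ⟨C, hC, g, h, fun i => by simpa only [(he i).1, (he i).2] using hd (e i)⟩

/-- If `b` is near a tuple `y` of a member `A` of `K`, then a copy of `b` close to `y` is found in
an extension of `A`. -/
theorem Near.exists_extension [Finite ι] (hK : IsFraisseClass K) (hA : A ∈ K) {b : ι → B}
    {y : ι → A} (h : Near K r b y) :
    ∃ C ∈ K, ∃ (e : Embedding A C) (b' : ι → C), SameType b b' ∧
      ∀ i, dist (b' i) (e (y i)) < r := by
  obtain ⟨C₀, hC₀, b₀, y₀, hb, hy, hd⟩ := h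
  obtain ⟨s, hs, hd⟩ := exists_lt_forall_lt hd
  obtain ⟨C, hC, g, e, hge⟩ := hK.amalgamate hC₀ hA hy.symm (sub_pos.2 hs)
  refine ⟨C, hC, e, fun i => g (b₀ i), hb.trans (.of_embedding g b₀), fun i => ?_⟩
  have h1 := g.isometry'.dist_eq (b₀ i) (y₀ i)
  linarith [dist_triangle (g (b₀ i)) (g (y₀ i)) (e (y i)), hge i, hd i]

theorem Near.trans [Finite ι] (hK : IsFraisseClass K) {a : ι → A} {b : ι → B} {c : ι → C}
    (h : Near K r a b) (h' : Near K s b c) : Near K (r + s) a c := by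
  obtain ⟨D, hD, a', b', ha, hb, hd⟩ := h
  obtain ⟨E, hE, e, c', hc, hd'⟩ := (h'.symm.congr (.refl c) hb).exists_extension hK hD
  refine ⟨E, hE, fun i => e (a' i), c', ha.trans (.of_embedding e a'), hc, fun i => ?_⟩
  have h1 := e.isometry'.dist_eq (a' i) (b' i)
  linarith [dist_triangle_right (e (a' i)) (c' i) (e (b' i)), hd i, hd' i]

end Near

/-! ### Approximate isomorphisms and amalgams -/

section Apx

variable {X Y Z : Type*} [MetricSpace X] [MetricSpace Y] [MetricSpace Z] {ι κ : Type}

/-- The approximate isometry between `X` and `Y` determined by copies `a'`, `b'`, in a common metric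
space, of families `a` in `X` and `b` in `Y`, relaxed by `s`. -/
noncomputable def amalgamFun (a : ι → X) (b : κ → Y) (a' : ι → Z) (b' : κ → Z) (s : ℝ≥0∞) :
    X → Y → ℝ≥0∞ :=
  fun x y => ⨅ i, ⨅ j, edist x (a i) + (edist (a' i) (b' j) + s) + edist (b j) y

theorem amalgamFun_le (a : ι → X) (b : κ → Y) (a' : ι → Z) (b' : κ → Z) (s : ℝ≥0∞) (i : ι)
    (j : κ) : amalgamFun a b a' b' s (a i) (b j) ≤ edist (a' i) (b' j) + s :=
  iInf₂_le_of_le i j (by simp)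

theorem amalgamFun_swap (a : ι → X) (b : κ → Y) (a' : ι → Z) (b' : κ → Z) (s : ℝ≥0∞) (x : X)
    (y : Y) : amalgamFun a b a' b' s x y = amalgamFun b a b' a' s y x := by
  unfold amalgamFun
  rw [iInf_comm]
  refine iInf_congr fun j => iInf_congr fun i => ?_
  rw [edist_comm x, edist_comm (a' i), edist_comm (b j)]
  ring

theorem isKatetov_amalgamFun {a : ι → X} {b : κ → Y} {a' : ι → Z} {b' : κ → Z}
    (ha : ∀ i j, edist (a i) (a j) = edist (a' i) (a' j))
    (hb : ∀ i j, edist (b i) (b j) = edist (b' i) (b' j)) (s : ℝ≥0∞) (x : X) :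
    IsKatetov fun y => amalgamFun a b a' b' s x y := by
  refine fun y y' => ⟨?_, ?_⟩
  · simp only [amalgamFun, ENNReal.add_iInf, le_iInf_iff]
    refine fun i j => iInf₂_le_of_le i j ?_
    calc edist x (a i) + (edist (a' i) (b' j) + s) + edist (b j) y
        ≤ edist x (a i) + (edist (a' i) (b' j) + s) + (edist (b j) y' + edist y' y) := by
          gcongr; exact edist_triangle _ _ _
      _ = _ := by rw [edist_comm y y']; ring
  · simp only [amalgamFun, ENNReal.add_iInf, ENNReal.iInf_add, le_iInf_iff]
    intro i j k l
    calc edist y y' ≤ edist y (b l) + edist (b l) (b j) + edist (b j) y' := edist_triangle4 _ _ _ _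
      _ ≤ edist y (b l) + (edist (b' l) (a' k) + edist (a' k) (a' i) + edist (a' i) (b' j)) +
          edist (b j) y' := by
        rw [hb]; gcongr; exact edist_triangle4 _ _ _ _
      _ ≤ edist y (b l) + (edist (b' l) (a' k) + (edist (a k) x + edist x (a i)) +
          edist (a' i) (b' j)) + edist (b j) y' := by
        rw [← ha]; gcongr; exact edist_triangle _ _ _
      _ ≤ edist y (b l) + (edist (b' l) (a' k) + (edist (a k) x + edist x (a i)) +
          edist (a' i) (b' j)) + edist (b j) y' + (s + s) := le_self_add
      _ = _ := by
        rw [edist_comm y, edist_comm (b' l), edist_comm (a k)]; ring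

theorem isBiKatetov_amalgamFun {a : ι → X} {b : κ → Y} {a' : ι → Z} {b' : κ → Z}
    (ha : ∀ i j, edist (a i) (a j) = edist (a' i) (a' j))
    (hb : ∀ i j, edist (b i) (b j) = edist (b' i) (b' j)) (s : ℝ≥0∞) :
    IsBiKatetov (amalgamFun a b a' b' s) :=
  ⟨isKatetov_amalgamFun ha hb s, fun y => by
    simpa only [amalgamFun_swap a b a' b'] using isKatetov_amalgamFun hb ha s y⟩

/-- A bi-Katětov function is below `amalgamFun` as soon as it is on the two families. -/
theorem IsBiKatetov.le_amalgamFun {χ : X → Y → ℝ≥0∞} (hχ : IsBiKatetov χ) {a : ι → X} {b : κ → Y}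
    {a' : ι → Z} {b' : κ → Z} {s : ℝ≥0∞}
    (h : ∀ i j, χ (a i) (b j) ≤ edist (a' i) (b' j) + s) (x : X) (y : Y) :
    χ x y ≤ amalgamFun a b a' b' s x y := by
  refine le_iInf₂ fun i j => ?_
  calc χ x y ≤ edist x (a i) + χ (a i) y := (hχ.2 y x (a i)).1
    _ ≤ edist x (a i) + (edist y (b j) + χ (a i) (b j)) := by
      gcongr; exact (hχ.1 (a i) y (b j)).1
    _ ≤ edist x (a i) + (edist y (b j) + (edist (a' i) (b' j) + s)) := by gcongr; exact h i j
    _ = _ := by rw [edist_comm y]; ring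

theorem ofPartial_id {i : X → Y} (hi : Isometry i) (x : X) (y : Y) :
    ofPartial (id : X → X) i x y = edist (i x) y := by
  refine le_antisymm (iInf_le_of_le x (by simp)) (le_iInf fun z => ?_)
  rw [← hi.edist_eq]
  exact edist_triangle _ _ _

theorem trivialExtension_apply (X₀ : Set X) (Y₀ : Set Y) (ψ : X₀ → Y₀ → ℝ≥0∞) (x : X) (y : Y) :
    trivialExtension X₀ Y₀ ψ x y =
      ⨅ (x₀ : X₀) (y₀ : Y₀), edist x (x₀ : X) + ψ x₀ y₀ + edist (y₀ : Y) y := by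
  have hX := ofPartial_id (i := (Subtype.val : X₀ → X)) isometry_subtype_coe
  have hY := ofPartial_id (i := (Subtype.val : Y₀ → Y)) isometry_subtype_coe
  simp only [trivialExtension, MetricFraisse.comp, pinv, hX, hY, ENNReal.iInf_add]
  rw [iInf_comm]
  simp only [edist_comm x]

/-- The approximate isometry given by `amalgamFun`. -/
noncomputable def amalgamApx (a : ι → X) (b : κ → Y) (a' : ι → Z) (b' : κ → Z)
    (ha : ∀ i j, edist (a i) (a j) = edist (a' i) (a' j))
    (hb : ∀ i j, edist (b i) (b j) = edist (b' i) (b' j)) (s : ℝ≥0∞) : Apx X Y :=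
  ⟨amalgamFun a b a' b' s, isBiKatetov_amalgamFun ha hb s⟩

theorem IsKatetov.sup {f g : X → ℝ≥0∞} (hf : IsKatetov f) (hg : IsKatetov g) :
    IsKatetov fun x => f x ⊔ g x := fun x y =>
  ⟨sup_le ((hf x y).1.trans (by gcongr; exact le_sup_left))
    ((hg x y).1.trans (by gcongr; exact le_sup_right)),
    (hf x y).2.trans (add_le_add le_sup_left le_sup_left)⟩

theorem isBiKatetov_sup {φ ψ : X → Y → ℝ≥0∞} (hφ : IsBiKatetov φ) (hψ : IsBiKatetov ψ) :
    IsBiKatetov (φ ⊔ ψ) := by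
  exact ⟨fun x => (hφ.1 x).sup (hψ.1 x), fun y => (hφ.2 y).sup (hψ.2 y)⟩

theorem continuous_apx_apply (x : X) (y : Y) : Continuous fun χ : Apx X Y => χ.1 x y :=
  (continuous_apply_apply x y).comp continuous_subtype_val

theorem exists_pos_of_mem_nhds_ennreal {c : ℝ≥0∞} {U : Set ℝ≥0∞} (hU : U ∈ 𝓝 c) :
    ∃ δ : ℝ≥0∞, 0 < δ ∧ ∀ e, c ≤ e → e ≤ c + δ → e ∈ U := by
  by_cases hc : c = ⊤
  · subst hc
    exact ⟨1, one_pos, fun e he _ => by rw [top_le_iff.1 he]; exact mem_of_mem_nhds hU⟩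
  · obtain ⟨δ, hδ, h⟩ := (ENNReal.hasBasis_nhds_of_ne_top hc).mem_iff.1 hU
    exact ⟨δ, hδ, fun e h1 h2 => h ⟨tsub_le_self.trans h1, h2⟩⟩

/-- The relation `φ < ψ` is witnessed on finitely many pairs, with some room. -/
theorem strictlyRefines_iff {φ ψ : Apx X Y} :
    StrictlyRefines φ ψ ↔ ∃ F : Set (X × Y), F.Finite ∧ ∃ δ : ℝ≥0∞, 0 < δ ∧
      ∀ χ : Apx X Y, (∀ p ∈ F, χ.1 p.1 p.2 ≤ φ.1 p.1 p.2 + δ) → χ ≤ ψ := by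
  constructor
  · intro h
    have h1 : {χ : Apx X Y | χ ≤ ψ} ∈ 𝓝 φ := mem_interior_iff_mem_nhds.1 h
    rw [nhds_subtype_eq_comap, mem_comap] at h1
    obtain ⟨S, hS, hSψ⟩ := h1
    rw [nhds_pi, Filter.mem_pi] at hS
    obtain ⟨I, hI, t, ht, hIt⟩ := hS
    simp only [nhds_pi, Filter.mem_pi] at ht
    choose J hJ u hu hJu using ht
    choose δ hδ hδu using fun x y => exists_pos_of_mem_nhds_ennreal (hu x y)
    let F : Set (X × Y) := ⋃ x ∈ I, Prod.mk x '' J x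
    have hF : F.Finite := hI.biUnion fun x _ => (hJ x).image _
    have h2 : ∀ᶠ ε in 𝓝[>] (0 : ℝ≥0∞), ∀ p ∈ F, ε < δ p.1 p.2 :=
      (eventually_all_finite hF).2 fun p _ =>
        mem_of_superset (Ioo_mem_nhdsGT (hδ p.1 p.2)) fun _ hε => hε.2
    obtain ⟨ε, h2, h3⟩ := (h2.and self_mem_nhdsWithin).exists
    refine ⟨F, hF, ε, h3, fun χ hχ => ?_⟩
    -- `χ ⊔ φ` agrees with `φ` on `F` up to `ε`, hence lies in the given neighbourhood of `φ`
    let χ' : Apx X Y := ⟨χ.1 ⊔ φ.1, isBiKatetov_sup χ.2 φ.2⟩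
    have h4 : χ' ∈ {χ : Apx X Y | χ ≤ ψ} := by
      refine hSψ (hIt fun x hx => hJu x fun y hy => hδu x y _ le_sup_right ?_)
      have hp : (x, y) ∈ F := mem_biUnion hx (mem_image_of_mem _ hy)
      exact sup_le ((hχ _ hp).trans (by gcongr; exact (h2 _ hp).le)) le_self_add
    exact le_trans (fun x y => le_sup_left) h4
  · rintro ⟨F, hF, δ, hδ, h⟩
    have hU : IsOpen {χ : Apx X Y | ∀ p ∈ F, φ.1 p.1 p.2 = ⊤ ∨
        χ.1 p.1 p.2 < φ.1 p.1 p.2 + δ} := by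
      have : {χ : Apx X Y | ∀ p ∈ F, φ.1 p.1 p.2 = ⊤ ∨ χ.1 p.1 p.2 < φ.1 p.1 p.2 + δ} =
          ⋂ p ∈ F, {χ | φ.1 p.1 p.2 = ⊤ ∨ χ.1 p.1 p.2 < φ.1 p.1 p.2 + δ} := by ext; simp
      rw [this]
      exact hF.isOpen_biInter fun p _ =>
        isOpen_const.union (isOpen_lt (continuous_apx_apply p.1 p.2) continuous_const)
    refine mem_interior.2 ⟨_, fun χ hχ => h χ fun p hp => ?_, hU, fun p hp => ?_⟩
    · obtain h | h := hχ p hp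
      · simp [h]
      · exact h.le
    · by_cases h : φ.1 p.1 p.2 = ⊤
      · exact .inl h
      · exact .inr (ENNReal.lt_add_right h hδ.ne')

theorem StrictlyRefines.le {φ ψ : Apx X Y} (h : StrictlyRefines φ ψ) : φ ≤ ψ :=
  interior_subset (s := {χ : Apx X Y | χ ≤ ψ}) h

end Apx

section ApxIso

variable {K : Set (MetricStructure.{u, v, w} L)} {A B C : MetricStructure.{u, v, w} L}
  {ι κ : Type} [Finite ι] [Finite κ]

theorem SameType.edist_eq {ι : Type} {a : ι → A} {b : ι → B} (h : SameType a b) (i j : ι) :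
    edist (a i) (a j) = edist (b i) (b j) := by
  rw [edist_dist, edist_dist, h.dist_eq]

/-- Two tuples with copies in a member of `K` determine an approximate isomorphism. -/
theorem amalgamApx_mem_apxIso (hC : C ∈ K) {a : ι → A} {b : κ → B} {a' : ι → C} {b' : κ → C}
    (ha : SameType a a') (hb : SameType b b') (s : ℝ≥0∞) :
    amalgamApx a b a' b' ha.edist_eq hb.edist_eq s ∈ apxIso K A B := by
  refine subset_closure ⟨amalgamApx a b a' b' ha.edist_eq hb.edist_eq 0, ?_, fun x y =>
    iInf₂_mono fun i j => by gcongr; exact zero_le⟩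
  obtain ⟨g, e, he, hg⟩ := ha.exists_partialIso
  obtain ⟨f, e', he', hf⟩ := hb.symm.exists_partialIso
  refine ⟨C, hC, g, f, funext₂ fun x y => ?_⟩
  simp only [amalgamApx, amalgamFun, MetricFraisse.comp, FinitePartialIso.toApx, ofPartial,
    ← he.iInf_comp, ← he'.iInf_comp, (hg _).1, (hg _).2, (hf _).1, (hf _).2]
  refine le_antisymm (le_iInf fun c => ?_) (le_iInf₂ fun i j => iInf_le_of_le (a' i) ?_)
  · simp only [ENNReal.add_iInf, ENNReal.iInf_add, le_iInf_iff]
    refine fun j i => iInf₂_le_of_le i j ?_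
    calc edist x (a i) + (edist (a' i) (b' j) + 0) + edist (b j) y
        ≤ edist x (a i) + (edist (a' i) c + edist c (b' j)) + edist (b j) y := by
          rw [add_zero]; gcongr; exact edist_triangle _ _ _
      _ = _ := by ring
  · refine (add_le_add (iInf_le _ i) (iInf_le _ j)).trans (le_of_eq ?_)
    rw [edist_self]
    ring

/-- An approximate isomorphism is witnessed, on finite tuples and up to `ε`, by copies of these
tuples in a member of `K`. -/
theorem exists_amalgam_of_mem_apxIso (hK : IsFraisseClass K) (hA : IsStructureOf K A)
    (hB : IsStructureOf K B) {ψ : Apx A B} (hψ : ψ ∈ apxIso K A B) (a : ι → A) (b : κ → B)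
    {ε : ℝ} (hε : 0 < ε) :
    ∃ C ∈ K, ∃ (a' : ι → C) (b' : κ → C), SameType a a' ∧ SameType b b' ∧
      ∀ i j, edist (a' i) (b' j) ≤ ψ.1 (a i) (b j) + ENNReal.ofReal ε := by
  obtain ⟨χ, ⟨χ₀, ⟨C, hC, g, f, hχ₀⟩, hχ⟩, hψ'⟩ : ∃ χ ∈ coarsenings (apxTwo K A B), ∀ i j,
      χ.1 (a i) (b j) ≤ ψ.1 (a i) (b j) + ENNReal.ofReal (ε / 2) := by
    have hU : IsOpen {χ : Apx A B | ∀ i j, ψ.1 (a i) (b j) = ⊤ ∨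
        χ.1 (a i) (b j) < ψ.1 (a i) (b j) + ENNReal.ofReal (ε / 2)} := by
      simp only [ofPred_forall]
      exact isOpen_iInter_of_finite fun i => isOpen_iInter_of_finite fun j =>
        isOpen_const.union (isOpen_lt (continuous_apx_apply (a i) (b j)) continuous_const)
    obtain ⟨χ, hχ, hχ'⟩ := mem_closure_iff.1 hψ _ hU fun i j => by
      by_cases h : ψ.1 (a i) (b j) = ⊤
      · exact .inl h
      · exact .inr (ENNReal.lt_add_right h (ENNReal.ofReal_pos.2 (half_pos hε)).ne')
    refine ⟨χ, hχ', fun i j => ?_⟩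
    obtain h | h := hχ i j
    · simp [h]
    · exact h.le
  have := g.finite_dom.to_subtype
  have := f.finite_dom.to_subtype
  obtain ⟨n, ⟨σ⟩⟩ := Finite.exists_equiv_fin g.dom
  obtain ⟨m, ⟨τ⟩⟩ := Finite.exists_equiv_fin f.dom
  let α : ι ⊕ Fin n → A := Sum.elim a fun k => (σ.symm k : A)
  let β : κ ⊕ Fin m → B := Sum.elim b fun k => f.toFun (τ.symm k)
  have hg : SameType (fun k => genTuple α (.inr k)) fun k => g.toFun (σ.symm k) :=
    ((sameType_genTuple α).comp Sum.inr).trans g.sameType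
  have hf : SameType (fun k => (τ.symm k : C)) fun k => genTuple β (.inr k) :=
    f.sameType.trans ((sameType_genTuple β).comp Sum.inr).symm
  -- amalgamate along `g` and then along `f`, so that both become almost the identity
  obtain ⟨D, hD, gA, gC, h1⟩ := hK.amalgamate (hA.generated_mem α) hC hg
    (show (0 : ℝ) < ε / 4 by positivity)
  obtain ⟨E, hE, gD, gB, h2⟩ := hK.amalgamate hD (hB.generated_mem β)
    ((SameType.of_embedding gC _).symm.trans hf) (show (0 : ℝ) < ε / 4 by positivity)
  refine ⟨E, hE, fun i => gD (gA (genTuple α (.inl i))), fun j => gB (genTuple β (.inl j)),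
    ?_, ?_, fun i j => ?_⟩
  · exact ((sameType_genTuple α).comp Sum.inl).symm.trans (.of_embedding (gD.comp gA) _)
  · exact ((sameType_genTuple β).comp Sum.inl).symm.trans (.of_embedding gB _)
  have hle : edist (gD (gA (genTuple α (.inl i)))) (gB (genTuple β (.inl j))) ≤
      χ₀.1 (a i) (b j) + ENNReal.ofReal (ε / 2) := by
    rw [hχ₀]
    simp only [MetricFraisse.comp, FinitePartialIso.toApx, ofPartial, ENNReal.add_iInf,
      ENNReal.iInf_add, le_iInf_iff, ← σ.symm.surjective.iInf_comp, ← τ.symm.surjective.iInf_comp]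
    intro c l k
    have e1 : edist (gD (gA (genTuple α (.inl i)))) (gD (gA (genTuple α (.inr k)))) =
        edist (a i) (σ.symm k : A) := by
      rw [gD.isometry'.edist_eq, gA.isometry'.edist_eq]; rfl
    have e2 : edist (gB (genTuple β (.inr l))) (gB (genTuple β (.inl j))) =
        edist (f.toFun (τ.symm l)) (b j) := gB.isometry'.edist_eq _ _
    have e3 : edist (gD (gA (genTuple α (.inr k)))) (gD (gC (g.toFun (σ.symm k)))) ≤
        ENNReal.ofReal (ε / 4) := by
      rw [gD.isometry'.edist_eq, edist_dist]; exact ENNReal.ofReal_le_ofReal (h1 k)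
    have e4 : edist (gD (gC (τ.symm l : C))) (gB (genTuple β (.inr l))) ≤
        ENNReal.ofReal (ε / 4) := by
      rw [edist_dist]; exact ENNReal.ofReal_le_ofReal (h2 l)
    have e5 : edist (gD (gC (g.toFun (σ.symm k)))) (gD (gC (τ.symm l : C))) ≤
        edist (g.toFun (σ.symm k)) c + edist c (τ.symm l : C) := by
      rw [gD.isometry'.edist_eq, gC.isometry'.edist_eq]; exact edist_triangle _ _ _
    have e6 : ENNReal.ofReal (ε / 2) = ENNReal.ofReal (ε / 4) + ENNReal.ofReal (ε / 4) := by
      rw [← ENNReal.ofReal_add (by positivity) (by positivity)]; congr 1; ring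
    calc _ ≤ edist (a i) (σ.symm k : A) + ENNReal.ofReal (ε / 4) +
          (edist (g.toFun (σ.symm k)) c + edist c (τ.symm l : C)) +
          (ENNReal.ofReal (ε / 4) + edist (f.toFun (τ.symm l)) (b j)) := by
          refine (edist_triangle4 _ (gD (gC (g.toFun (σ.symm k)))) (gD (gC (τ.symm l : C))) _).trans
            (add_le_add (add_le_add ?_ e5) ?_)
          · exact (edist_triangle _ _ _).trans (add_le_add e1.le e3)
          · exact (edist_triangle _ _ _).trans (add_le_add e4 e2.le)
      _ = _ := by rw [e6]; ring
  calc _ ≤ ψ.1 (a i) (b j) + ENNReal.ofReal (ε / 2) + ENNReal.ofReal (ε / 2) :=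
        hle.trans (add_le_add ((hχ _ _).trans (hψ' i j)) le_rfl)
    _ = _ := by
      rw [add_assoc, ← ENNReal.ofReal_add (by positivity) (by positivity)]; congr 2; ring

/-- The pseudo-distance of `𝒦ₙ` in terms of amalgams. -/
theorem distK_lt_iff (hK : IsFraisseClass K) {n : ℕ} {p q : Pointed K n} {r : ℝ} (hr : 0 < r) :
    distK p q < ENNReal.ofReal r ↔ Near K r p.tuple q.tuple := by
  constructor
  · intro h
    simp only [distK, iInf_lt_iff] at h
    obtain ⟨ψ, ⟨hψ, -⟩, h⟩ := h
    obtain ⟨s, hs, hsr⟩ := exists_between h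
    have hs' : s ≠ ⊤ := hsr.ne_top
    have hsr' : s.toReal < r := (ENNReal.lt_ofReal_iff_toReal_lt hs').1 hsr
    obtain ⟨C, hC, a', b', ha, hb, hd⟩ := exists_amalgam_of_mem_apxIso hK
      (hK.hereditary _ p.mem) (hK.hereditary _ q.mem) hψ p.tuple q.tuple
      (half_pos (sub_pos.2 hsr'))
    refine ⟨C, hC, a', b', ha, hb, fun i => ?_⟩
    have h1 : edist (a' i) (b' i) ≤ s + ENNReal.ofReal ((r - s.toReal) / 2) :=
      (hd i i).trans (by gcongr; exact (le_iSup (fun i => ψ.1 _ _) i).trans hs.le)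
    nth_rewrite 1 [← ENNReal.ofReal_toReal hs'] at h1
    rw [← ENNReal.ofReal_add ENNReal.toReal_nonneg (by linarith),
      edist_le_ofReal (by linarith [ENNReal.toReal_nonneg (a := s)])] at h1
    linarith
  · intro h
    obtain ⟨s, hs, C, hC, a', b', ha, hb, hd⟩ := h.exists_lt
    -- the distance between the copies, extended trivially, is admissible in the infimum `d^𝒦`
    have key : distK p q ≤ ENNReal.ofReal s := by
      refine iInf₂_le_of_le (amalgamApx _ _ a' b' ha.edist_eq hb.edist_eq 0)
        ⟨amalgamApx_mem_apxIso hC ha hb 0, ?_⟩ (iSup_le fun i => ?_)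
      · set φ := amalgamApx p.tuple q.tuple a' b' ha.edist_eq hb.edist_eq 0
        refine ⟨⟨fun x y => φ.1 x y, fun x y y' => φ.2.1 x y y', fun y x x' => φ.2.2 y x x'⟩, ?_⟩
        refine funext₂ fun x y => ?_
        rw [trivialExtension_apply]
        refine le_antisymm (le_iInf₂ fun x₀ y₀ => ?_) (le_iInf₂ fun i j => ?_)
        · calc φ.1 x y ≤ edist x x₀ + φ.1 x₀ y := (φ.2.2 y x x₀).1
            _ ≤ edist x x₀ + (edist y y₀ + φ.1 x₀ y₀) := by gcongr; exact (φ.2.1 x₀ y y₀).1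
            _ = _ := by rw [edist_comm y]; ring
        · refine iInf₂_le_of_le ⟨p.tuple i, i, rfl⟩ ⟨q.tuple j, j, rfl⟩ ?_
          gcongr
          exact amalgamFun_le _ _ _ _ _ i j
      · refine (amalgamFun_le _ _ _ _ _ i i).trans ?_
        rw [add_zero, edist_dist]
        exact ENNReal.ofReal_le_ofReal (hd i).le
    exact key.trans_lt ((ENNReal.ofReal_lt_ofReal_iff hr).2 hs)

end ApxIso

/-! ### The pseudo-metric spaces `𝒦ₙ` -/

section Pointed

variable {K : Set (MetricStructure.{u, v, w} L)} {A B C M : MetricStructure.{u, v, w} L}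
  {n m : ℕ} {ι : Type}

theorem distK_ne_top (hK : IsFraisseClass K) (p q : Pointed K n) : distK p q ≠ ⊤ := by
  obtain ⟨C, hC, ⟨g⟩, ⟨h⟩⟩ := hK.jointEmbedding _ p.mem _ q.mem
  have hr : ∀ i, dist (g (p.tuple i)) (h (q.tuple i)) <
      1 + ∑ j, dist (g (p.tuple j)) (h (q.tuple j)) := fun i =>
    (Finset.single_le_sum (f := fun j => dist (g (p.tuple j)) (h (q.tuple j)))
      (fun j _ => dist_nonneg) (Finset.mem_univ i)).trans_lt (lt_one_add _)
  exact ((distK_lt_iff hK (by positivity)).2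
    ⟨C, hC, _, _, .of_embedding g _, .of_embedding h _, hr⟩).ne_top

theorem toReal_distK_lt_iff (hK : IsFraisseClass K) {p q : Pointed K n} {r : ℝ} (hr : 0 < r) :
    (distK p q).toReal < r ↔ Near K r p.tuple q.tuple := by
  rw [← distK_lt_iff hK hr, ENNReal.lt_ofReal_iff_toReal_lt (distK_ne_top hK p q)]

theorem distK_eq_zero_iff_near (hK : IsFraisseClass K) {p q : Pointed K n} :
    distK p q = 0 ↔ ∀ r > 0, Near K r p.tuple q.tuple := by
  refine ⟨fun h r hr => (distK_lt_iff hK hr).1 (by simpa [h] using hr), fun h => ?_⟩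
  by_contra h0
  have hr := ENNReal.toReal_pos h0 (distK_ne_top hK p q)
  exact lt_irrefl _ ((toReal_distK_lt_iff hK hr).2 (h _ hr))

/-- The pseudo-metric `d^K` on `𝒦ₙ`; its topology is the given one. -/
noncomputable abbrev pointedPseudoMetric (hK : IsFraisseClass K) (n : ℕ) :
    PseudoMetricSpace (Pointed K n) :=
  PseudoMetricSpace.ofDistTopology (fun p q => (distK p q).toReal)
    (fun p => le_antisymm (le_of_forall_gt fun r hr => (toReal_distK_lt_iff hK hr).2
      (.of_sameType (hK.hereditary _ p.mem) (.refl _) hr)) ENNReal.toReal_nonneg)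
    (fun p q => eq_of_forall_gt_iff fun r => by
      by_cases hr : 0 < r
      · rw [toReal_distK_lt_iff hK hr, toReal_distK_lt_iff hK hr]
        exact ⟨.symm, .symm⟩
      · exact iff_of_false (fun h => hr (ENNReal.toReal_nonneg.trans_lt h))
          fun h => hr (ENNReal.toReal_nonneg.trans_lt h))
    (fun p q s => le_of_forall_pos_lt_add fun ε hε => by
      have h1 : (distK p q).toReal < (distK p q).toReal + ε / 2 := by linarith
      have h2 : (distK q s).toReal < (distK q s).toReal + ε / 2 := by linarith
      have h3 := ENNReal.toReal_nonneg (a := distK p q)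
      have h4 := ENNReal.toReal_nonneg (a := distK q s)
      rw [toReal_distK_lt_iff hK (by linarith)] at h1 h2
      rw [toReal_distK_lt_iff hK (by linarith)]
      exact (h1.trans hK h2).mono (by linarith))
    (fun U => by
      refine forall₂_congr fun p _ => ⟨?_, ?_⟩
      · rintro ⟨ε, hε, h⟩
        obtain ⟨δ, hδ, hδε⟩ := exists_between hε
        refine ⟨δ.toReal, ENNReal.toReal_pos hδ.ne' hδε.ne_top, fun q hq => h q ?_⟩
        exact ((ENNReal.toReal_lt_toReal (distK_ne_top hK p q) hδε.ne_top).1 hq).trans hδε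
      · rintro ⟨ε, hε, h⟩
        exact ⟨.ofReal ε, ENNReal.ofReal_pos.2 hε, fun q hq => h q
          ((ENNReal.lt_ofReal_iff_toReal_lt (distK_ne_top hK p q)).1 hq)⟩)

theorem sameType_ofTuple (hA : IsStructureOf K A) (a : Fin n → A) :
    SameType (Pointed.ofTuple hA a).tuple a :=
  sameType_genTuple a

/-- Continuity property, for predicates: at a given type, a predicate is continuous uniformly over
all structures in the class. -/
theorem IsFraisseClass.exists_dist_pred_lt (hK : IsFraisseClass K) (hA : IsStructureOf K A)
    (R : L.Relations n) (a : Fin n → A) {ε : ℝ} (hε : 0 < ε) :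
    ∃ δ > 0, ∀ C : MetricStructure.{u, v, w} L, IsStructureOf K C → ∀ a' b' : Fin n → C,
      SameType a a' → (∀ i, dist (a' i) (b' i) < δ) → dist (C.pred R a') (C.pred R b') < ε := by
  let _ := pointedPseudoMetric hK n
  obtain ⟨δ, hδ, h⟩ := Metric.continuous_iff'.1 (hK.continuous_pred n R) (.ofTuple hA a) ε hε
    |> Metric.eventually_nhds_iff.1
  refine ⟨δ, hδ, fun C hC a' b' ha hd => ?_⟩
  have h1 := @h (.ofTuple hC b') <| by
    rw [dist_comm]
    exact (toReal_distK_lt_iff hK hδ).2 ((Near.of_dist_lt hC hd).congr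
      (ha.symm.trans (sameType_ofTuple hA a).symm) (sameType_ofTuple hC b').symm)
  rw [dist_comm]
  have e := ((sameType_ofTuple hA a).trans ha).pred_eq R id
  simp only [id] at e
  rw [← e]
  exact h1

/-- Continuity property, for functions: at a given type, a function symbol is continuous uniformly
over all structures in the class. -/
theorem IsFraisseClass.exists_dist_func_lt (hK : IsFraisseClass K) (hA : IsStructureOf K A)
    (f : L.Functions n) (a : Fin n → A) {ε : ℝ} (hε : 0 < ε) :
    ∃ δ > 0, ∀ C : MetricStructure.{u, v, w} L, IsStructureOf K C → ∀ a' b' : Fin n → C,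
      SameType a a' → (∀ i, dist (a' i) (b' i) < δ) → dist (C.func f a') (C.func f b') < ε := by
  let _ := pointedPseudoMetric hK (n + 1)
  let _ := pointedPseudoMetric hK (n + 1 + 1)
  -- `(a, f a)` is compared to `(b', f a')`: adding one more value of `f` yields `(a, f a, f a)`
  -- and `(b', f a', f b')`
  let p : Pointed K (n + 1) := .ofTuple hA (Fin.snoc (α := fun _ => A) a (A.func f a))
  obtain ⟨δ, hδ, h⟩ := Metric.continuous_iff'.1 (hK.continuous_func n f 1) p (ε / 2) (half_pos hε)
    |> Metric.eventually_nhds_iff.1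
  refine ⟨δ, hδ, fun C hC a' b' ha hd => ?_⟩
  let q : Pointed K (n + 1) := .ofTuple hC (Fin.snoc (α := fun _ => C) b' (C.func f a'))
  have h1 : SameType (Fin.snoc (α := fun _ => A) a (A.func f a))
      (Fin.snoc (α := fun _ => C) a' (C.func f a')) := by
    let ts : Fin (n + 1) → L.Term (Fin n) :=
      Fin.snoc (α := fun _ => L.Term (Fin n)) (fun i => .var i) (.func f fun i => .var i)
    convert ha.realize ts using 1 <;> funext i <;> refine Fin.lastCases ?_ (fun i => ?_) i <;>
      simp [ts, realize]
  have h2 : dist q p < δ := by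
    rw [dist_comm]
    refine (toReal_distK_lt_iff hK hδ).2 ((Near.of_dist_lt hC fun i => ?_).congr
      (h1.symm.trans (sameType_ofTuple hA _).symm) (sameType_ofTuple hC _).symm)
    refine Fin.lastCases ?_ (fun i => ?_) i
    · simpa using hδ
    · simpa using hd i
  obtain ⟨D, -, x, y, hx, hy, hxy⟩ := (toReal_distK_lt_iff hK (half_pos hε)).1 (h h2)
  have E1 := hx.dist_eq (Fin.last n).castSucc (Fin.last (n + 1))
  have E2 := hy.dist_eq (Fin.last n).castSucc (Fin.last (n + 1))
  simp only [Pointed.snocFunc, Fin.snoc_castSucc, Fin.snoc_last] at E1 E2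
  have e1 : dist (C.func f a') (C.func f b') =
      dist (x (Fin.last n).castSucc) (x (Fin.last (n + 1))) := by
    rw [← E1]
    change _ = dist (Fin.snoc (α := fun _ => C) b' (C.func f a') (Fin.last n))
      (C.func f fun i => Fin.snoc (α := fun _ => C) b' (C.func f a') i.castSucc)
    simp
  have e2 : dist (y (Fin.last n).castSucc) (y (Fin.last (n + 1))) = 0 := by
    rw [← E2]
    change dist (Fin.snoc (α := fun _ => A) a (A.func f a) (Fin.last n))
      (A.func f fun i => Fin.snoc (α := fun _ => A) a (A.func f a) i.castSucc) = 0
    simp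
  rw [e1]
  linarith [dist_triangle4 (x (Fin.last n).castSucc) (y (Fin.last n).castSucc)
    (y (Fin.last (n + 1))) (x (Fin.last (n + 1))), hxy (Fin.last n).castSucc,
    hxy (Fin.last (n + 1)), dist_comm (x (Fin.last (n + 1))) (y (Fin.last (n + 1)))]

/-- Continuity of terms at a given type, uniformly over all structures in the class. -/
theorem IsFraisseClass.exists_dist_realize_lt (hK : IsFraisseClass K) (hA : IsStructureOf K A)
    (t : L.Term ι) (a : ι → A) {ε : ℝ} (hε : 0 < ε) :
    ∃ δ > 0, ∀ C : MetricStructure.{u, v, w} L, IsStructureOf K C → ∀ a' b' : ι → C,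
      SameType a a' → (∀ i, dist (a' i) (b' i) < δ) → dist (realize a' t) (realize b' t) < ε := by
  induction t generalizing ε with
  | var i => exact ⟨ε, hε, fun C _ a' b' _ h => h i⟩
  | func f ts ih =>
    obtain ⟨η, hη, hf⟩ := hK.exists_dist_func_lt hA f (fun j => realize a (ts j)) hε
    choose δ hδ h using fun j => ih j hη
    have h1 : ∀ᶠ r in 𝓝[>] (0 : ℝ), ∀ j, r < δ j :=
      eventually_all.2 fun j => mem_of_superset (Ioo_mem_nhdsGT (hδ j)) fun _ hr => hr.2
    obtain ⟨r, h1, hr⟩ := (h1.and self_mem_nhdsWithin).exists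
    exact ⟨r, hr, fun C hC a' b' ha hd => hf C hC _ _ (ha.realize ts)
      fun j => h j C hC a' b' ha fun i => (hd i).trans (h1 j)⟩

/-- The value of a type-invariant quantity, continuous in the class as well as in the structure
`M`, passes to limits of tuples of `M`. -/
theorem eq_of_near [Finite ι] (hK : IsFraisseClass K) {b : ι → B} {x : ι → M}
    (h : ∀ δ > 0, ∃ y : ι → M, (∀ i, dist (x i) (y i) < δ) ∧ Near K δ b y)
    (Q : ∀ A : MetricStructure.{u, v, w} L, (ι → A) → ℝ)
    (hQ : ∀ (A B : MetricStructure.{u, v, w} L) (a : ι → A) (b : ι → B), SameType a b →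
      Q A a = Q B b) (hM : Continuous (Q M))
    (hQK : ∀ ε > 0, ∃ δ > 0, ∀ C : MetricStructure.{u, v, w} L, IsStructureOf K C →
      ∀ a' b' : ι → C, SameType b a' → (∀ i, dist (a' i) (b' i) < δ) →
        dist (Q C a') (Q C b') < ε) : Q B b = Q M x := by
  have := Fintype.ofFinite ι
  refine eq_of_forall_dist_le fun ε hε => ?_
  obtain ⟨δ, hδ, h1⟩ := hQK (ε / 2) (half_pos hε)
  obtain ⟨δ', hδ', h2⟩ := Metric.continuous_iff.1 hM x (ε / 2) (half_pos hε)
  obtain ⟨y, hxy, C, hC, b', y', hb, hy, hd⟩ := h (min δ δ') (lt_min hδ hδ')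
  have h3 := h1 C (hK.hereditary C hC) b' y' hb fun i => (hd i).trans_le (min_le_left _ _)
  have h4 := h2 y ((dist_pi_lt_iff hδ').2 fun i => by
    rw [dist_comm]; exact (hxy i).trans_le (min_le_right _ _))
  rw [hQ B C b b' hb]
  rw [hQ M C y y' hy] at h4
  linarith [dist_triangle (Q C b') (Q C y') (Q M x)]

/-- Types pass to limits: if tuples of `M` converge to `x` in `M`, and to the type of `b` in the
sense of `d^K`, then `x` has the type of `b`. -/
theorem SameType.of_near [Finite ι] (hK : IsFraisseClass K) (hB : IsStructureOf K B) {b : ι → B}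
    {x : ι → M} (h : ∀ δ > 0, ∃ y : ι → M, (∀ i, dist (x i) (y i) < δ) ∧ Near K δ b y) :
    SameType b x := by
  constructor
  · intro s t
    refine eq_of_near hK h (fun A a => dist (MetricFraisse.realize a s) (MetricFraisse.realize a t))
      (fun _ _ _ _ h => h.1 s t) ((continuous_realize M s).dist (continuous_realize M t))
      fun ε hε => ?_
    obtain ⟨δ, hδ, h1⟩ := hK.exists_dist_realize_lt hB s b (half_pos hε)
    obtain ⟨δ', hδ', h2⟩ := hK.exists_dist_realize_lt hB t b (half_pos hε)
    refine ⟨min δ δ', lt_min hδ hδ', fun C hC a' b' ha hd => ?_⟩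
    have h3 := h1 C hC a' b' ha fun i => (hd i).trans_le (min_le_left _ _)
    have h4 := h2 C hC a' b' ha fun i => (hd i).trans_le (min_le_right _ _)
    refine (dist_dist_dist_le _ _ _ _).trans_lt ?_
    linarith
  · intro n R ts
    refine eq_of_near hK h (fun A a => A.pred R fun j => MetricFraisse.realize a (ts j))
      (fun _ _ _ _ h => h.2 R ts)
      ((M.continuous_pred R).comp (continuous_pi fun j => continuous_realize M (ts j)))
      fun ε hε => ?_
    obtain ⟨η, hη, hR⟩ :=
      hK.exists_dist_pred_lt hB R (fun j => MetricFraisse.realize b (ts j)) hε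
    choose δ hδ h using fun j => hK.exists_dist_realize_lt hB (ts j) b hη
    have h1 : ∀ᶠ r in 𝓝[>] (0 : ℝ), ∀ j, r < δ j :=
      eventually_all.2 fun j => mem_of_superset (Ioo_mem_nhdsGT (hδ j)) fun _ hr => hr.2
    obtain ⟨r, h1, hr⟩ := (h1.and self_mem_nhdsWithin).exists
    exact ⟨r, hr, fun C hC a' b' ha hd => hR C hC _ _ (ha.realize ts)
      fun j => h j C hC a' b' ha fun i => (hd i).trans (h1 j)⟩

theorem distK_eq_zero_iff (hK : IsFraisseClass K) {p q : Pointed K n} :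
    distK p q = 0 ↔ SameType p.tuple q.tuple := by
  rw [distK_eq_zero_iff_near hK]
  exact ⟨fun h => .of_near hK (hK.hereditary _ p.mem) fun δ hδ =>
    ⟨q.tuple, fun i => (dist_self _).trans_lt hδ, h δ hδ⟩,
    fun h r hr => .of_sameType (hK.hereditary _ p.mem) h hr⟩

theorem toQuot_eq_iff (hK : IsFraisseClass K) {p q : Pointed K n} :
    p.toQuot = q.toQuot ↔ SameType p.tuple q.tuple := by
  refine ⟨fun h => ?_, fun h => Quot.sound ((distK_eq_zero_iff hK).2 h)⟩
  have h' := Quot.eqvGen_exact h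
  clear h
  induction h' with
  | rel _ _ h => exact (distK_eq_zero_iff hK).1 h
  | refl => exact .refl _
  | symm _ _ _ ih => exact ih.symm
  | trans _ _ _ _ _ ih ih' => exact ih.trans ih'

/-! ### The inverse limit is Polish -/

/-- The quotient `𝒦ₙ / ker d^𝒦` is Polish. -/
theorem polishSpace_pointedQuot (hK : IsFraisseClass K) (n : ℕ) :
    PolishSpace (PointedQuot K n) := by
  let _ := pointedPseudoMetric hK n
  have hd : ∀ p q : Pointed K n, dist p q = (distK p q).toReal := fun _ _ => rfl
  have hr : ∀ p q : Pointed K n, distK p q = 0 ↔ Inseparable p q := fun p q => by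
    rw [Metric.inseparable_iff, hd, ENNReal.toReal_eq_zero_iff,
      or_iff_left (distK_ne_top hK p q)]
  let e : PointedQuot K n ≃ₜ SeparationQuotient (Pointed K n) :=
    { toEquiv := Quot.congrRight hr
      continuous_toFun := continuous_quot_lift _ continuous_quot_mk
      continuous_invFun := continuous_quot_lift _ continuous_quot_mk }
  have : CompleteSpace (Pointed K n) := by
    refine Metric.complete_of_cauchySeq_tendsto fun p hp => ?_
    obtain ⟨q, hq⟩ := hK.complete n p fun ε hε => by
      obtain ⟨δ, hδ, hδε⟩ := exists_between hε
      obtain ⟨N, hN⟩ := Metric.cauchySeq_iff.1 hp δ.toReal (ENNReal.toReal_pos hδ.ne' hδε.ne_top)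
      exact ⟨N, fun i hi j hj => ((ENNReal.toReal_lt_toReal (distK_ne_top hK _ _)
        hδε.ne_top).1 (hN i hi j hj)).trans hδε⟩
    refine ⟨q, tendsto_iff_dist_tendsto_zero.2 ?_⟩
    exact (ENNReal.tendsto_toReal ENNReal.zero_ne_top).comp hq
  have : TopologicalSpace.SeparableSpace (Pointed K n) := by
    obtain ⟨S, hS, hSd⟩ := hK.separable n
    refine ⟨S, hS, Metric.dense_iff.2 fun p r hr => ?_⟩
    obtain ⟨q, hq, hpq⟩ := hSd p (.ofReal r) (ENNReal.ofReal_pos.2 hr)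
    refine ⟨q, ?_, hq⟩
    rw [Metric.mem_ball, dist_comm, hd]
    exact (ENNReal.lt_ofReal_iff_toReal_lt (distK_ne_top hK p q)).1 hpq
  have : TopologicalSpace.SeparableSpace (SeparationQuotient (Pointed K n)) :=
    inferInstanceAs (TopologicalSpace.SeparableSpace (Quotient _))
  have : SecondCountableTopology (SeparationQuotient (Pointed K n)) :=
    UniformSpace.secondCountable_of_separable _
  have : CompleteSpace (SeparationQuotient (Pointed K n)) := inferInstance
  have : PolishSpace (SeparationQuotient (Pointed K n)) := inferInstance
  exact e.isClosedEmbedding.polishSpace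

theorem sameType_init (hK : IsFraisseClass K) (p : Pointed K (n + 1)) :
    SameType (p.init hK.hereditary).tuple fun i : Fin n => p.tuple i.castSucc :=
  sameType_ofTuple _ _

theorem near_init (hK : IsFraisseClass K) {r : ℝ} {p q : Pointed K (n + 1)}
    (h : Near K r p.tuple q.tuple) :
    Near K r (p.init hK.hereditary).tuple (q.init hK.hereditary).tuple :=
  (h.comp Fin.castSucc).congr (sameType_init hK p).symm (sameType_init hK q).symm

theorem polishSpace_inverseLimit (hK : IsFraisseClass K) :
    PolishSpace (InverseLimit hK.hereditary) := by
  have := polishSpace_pointedQuot hK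
  let ρ : ∀ n, PointedQuot K (n + 1) → PointedQuot K n := fun n =>
    Quot.lift (fun p => (p.init hK.hereditary).toQuot) fun p q h =>
      (toQuot_eq_iff hK).2 (((sameType_init hK p).trans
        (((distK_eq_zero_iff hK).1 h).comp Fin.castSucc)).trans (sameType_init hK q).symm)
  have hρ : ∀ n, Continuous (ρ n) := fun n => by
    let _ := pointedPseudoMetric hK n
    let _ := pointedPseudoMetric hK (n + 1)
    refine continuous_quot_lift _ (continuous_quot_mk.comp (Metric.continuous_iff.2 ?_))
    exact fun p ε hε => ⟨ε, hε, fun q hq => (toReal_distK_lt_iff hK hε).2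
      (near_init hK ((toReal_distK_lt_iff hK hε).1 hq))⟩
  have hc : IsClosed {ξ : ∀ n, PointedQuot K n |
      ∀ n, ∃ p : Pointed K (n + 1),
        p.toQuot = ξ (n + 1) ∧ (p.init hK.hereditary).toQuot = ξ n} := by
    have : {ξ : ∀ n, PointedQuot K n | ∀ n, ∃ p : Pointed K (n + 1),
        p.toQuot = ξ (n + 1) ∧ (p.init hK.hereditary).toQuot = ξ n} =
        ⋂ n, {ξ | ρ n (ξ (n + 1)) = ξ n} := by
      ext ξ
      simp only [mem_ofPred_eq, mem_iInter]
      refine forall_congr' fun n => ⟨?_, fun h => ?_⟩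
      · rintro ⟨p, hp, hp'⟩
        rw [← hp, ← hp']; rfl
      · obtain ⟨p, hp⟩ := Quot.exists_rep (ξ (n + 1))
        exact ⟨p, hp, by rw [← h, ← hp]⟩
    rw [this]
    exact isClosed_iInter fun n =>
      isClosed_eq ((hρ n).comp (continuous_apply _)) (continuous_apply n)
  exact hc.polishSpace

end Pointed

/-! ### Direct limits of sequences of members of the class -/

section DirectLimit

variable {K : Set (MetricStructure.{u, v, w} L)}

section Chain

variable {A : ℕ → MetricStructure.{u, v, w} L} {e : ∀ n, Embedding (A n) (A (n + 1))}
  {X : Type w} {j : ∀ n, A n → X} {m : ℕ}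

theorem exists_transition (hj : ∀ n x, j (n + 1) (e n x) = j n x) {n N : ℕ} (h : n ≤ N) :
    ∃ φ : Embedding (A n) (A N), ∀ x, j N (φ x) = j n x := by
  induction N, h using Nat.le_induction with
  | base => exact ⟨⟨id, isometry_id, fun _ _ => rfl, fun _ _ => rfl⟩, fun _ => rfl⟩
  | succ N _ ih =>
    obtain ⟨φ, hφ⟩ := ih
    exact ⟨(e N).comp φ, fun x => (hj N _).trans (hφ x)⟩

variable [MetricSpace X]

theorem exists_tuple_near (hj : ∀ n x, j (n + 1) (e n x) = j n x)
    (hd : Dense (⋃ n, range (j n))) (x : Fin m → X) {ε : ℝ} (hε : 0 < ε) :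
    ∃ (n : ℕ) (y : Fin m → A n), ∀ i, dist (x i) (j n (y i)) < ε := by
  have h : ∀ i, ∃ n, ∃ y : A n, dist (x i) (j n y) < ε := fun i => by
    obtain ⟨z, hz, hxz⟩ := hd.exists_dist_lt (x i) hε
    obtain ⟨n, y, rfl⟩ := mem_iUnion.1 hz
    exact ⟨n, y, hxz⟩
  choose n y hy using h
  choose φ hφ using fun i => exists_transition hj (Finset.le_sup (f := n) (Finset.mem_univ i))
  exact ⟨Finset.univ.sup n, fun i => φ i (y i), fun i => by rw [hφ]; exact hy i⟩

theorem near_of_dist_lt (hK : IsFraisseClass K) (hA : ∀ n, A n ∈ K) (hi : ∀ n, Isometry (j n))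
    (hj : ∀ n x, j (n + 1) (e n x) = j n x) {x : Fin m → X} {n n' : ℕ} {y : Fin m → A n}
    {y' : Fin m → A n'} {ε : ℝ} (h : ∀ i, dist (x i) (j n (y i)) < ε)
    (h' : ∀ i, dist (x i) (j n' (y' i)) < ε) : Near K (ε + ε) y y' := by
  obtain ⟨φ, hφ⟩ := exists_transition hj (le_max_left n n')
  obtain ⟨φ', hφ'⟩ := exists_transition hj (le_max_right n n')
  have h1 : Near K (ε + ε) (fun i => φ (y i)) fun i => φ' (y' i) :=
    .of_dist_lt (hK.hereditary _ (hA _)) fun i => by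
      rw [← (hi _).dist_eq, hφ, hφ']
      linarith [h i, h' i, dist_triangle_left (j n (y i)) (j n' (y' i)) (x i)]
  exact h1.congr (SameType.of_embedding φ y).symm (SameType.of_embedding φ' y').symm

/-- By completeness of `𝒦ₘ`, the type of a tuple in the completed union is realized in the class. -/
theorem exists_pointed_near (hK : IsFraisseClass K) (hA : ∀ n, A n ∈ K)
    (hi : ∀ n, Isometry (j n)) (hj : ∀ n x, j (n + 1) (e n x) = j n x)
    (hd : Dense (⋃ n, range (j n))) (x : Fin m → X) :
    ∃ p : Pointed K m, ∀ δ > 0, ∃ η > 0, ∀ (n : ℕ) (y : Fin m → A n),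
      (∀ i, dist (x i) (j n (y i)) < η) → Near K δ p.tuple y := by
  choose n y hy using fun k : ℕ =>
    exists_tuple_near hj hd x (Nat.one_div_pos_of_nat (α := ℝ) (n := k))
  let p : ℕ → Pointed K m := fun k => .ofTuple (hK.hereditary _ (hA (n k))) (y k)
  have hp : ∀ k, SameType (y k) (p k).tuple := fun k => (sameType_ofTuple _ _).symm
  have hsmall : ∀ {ε : ℝ}, 0 < ε → ∃ N, ∀ k ≥ N, ∀ i, dist (x i) (j (n k) (y k i)) < ε := by
    intro ε hε
    obtain ⟨N, hN⟩ := exists_nat_one_div_lt hε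
    exact ⟨N, fun k hk i => (hy k i).trans ((Nat.one_div_le_one_div hk).trans_lt hN)⟩
  obtain ⟨q, hq⟩ := hK.complete m p fun ε hε => by
    obtain ⟨δ, hδ, hδε⟩ := exists_between hε
    have hδ' := ENNReal.toReal_pos hδ.ne' hδε.ne_top
    obtain ⟨N, hN⟩ := hsmall (half_pos hδ')
    refine ⟨N, fun k hk l hl => lt_trans ?_ hδε⟩
    rw [← ENNReal.ofReal_toReal hδε.ne_top, distK_lt_iff hK hδ']
    exact ((near_of_dist_lt hK hA hi hj (hN k hk) (hN l hl)).congr (hp k) (hp l)).mono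
      (by linarith)
  refine ⟨q, fun δ hδ => ⟨δ / 4, by positivity, fun n' y' hy' => ?_⟩⟩
  obtain ⟨N, hN⟩ := hsmall (show 0 < δ / 4 by positivity)
  obtain ⟨k, hk, hkN⟩ := ((hq.eventually_lt_const (ENNReal.ofReal_pos.2 (half_pos hδ))).and
    (eventually_ge_atTop N)).exists
  have h1 := ((distK_lt_iff hK (half_pos hδ)).1 hk).symm.congr (.refl _) (hp k).symm
  exact (h1.trans hK (near_of_dist_lt hK hA hi hj (hN k hkN) hy')).mono (by linarith)

/-- Two tuples of the union close to a tuple `x` of the completion are, in an extension in the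
class, simultaneously close to one and the same realization of the type of `x`. -/
theorem exists_common_extension (hK : IsFraisseClass K) (hA : ∀ n, A n ∈ K)
    (hi : ∀ n, Isometry (j n)) (hj : ∀ n x, j (n + 1) (e n x) = j n x)
    (hd : Dense (⋃ n, range (j n))) (x : Fin m → X) :
    ∃ p : Pointed K m, ∀ δ > 0, ∃ η > 0, ∀ (n n' : ℕ) (y : Fin m → A n) (y' : Fin m → A n'),
      (∀ i, dist (x i) (j n (y i)) < η) → (∀ i, dist (x i) (j n' (y' i)) < η) →
      ∃ C ∈ K, ∃ (φ : Embedding (A n) C) (φ' : Embedding (A n') C) (b : Fin m → C),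
        SameType p.tuple b ∧ (∀ i, dist (b i) (φ (y i)) < δ) ∧ (∀ i, dist (b i) (φ' (y' i)) < δ) ∧
        ∀ u u', dist (φ u) (φ' u') = dist (j n u) (j n' u') := by
  obtain ⟨p, hp⟩ := exists_pointed_near hK hA hi hj hd x
  refine ⟨p, fun δ hδ => ?_⟩
  obtain ⟨η, hη, h⟩ := hp (δ / 2) (half_pos hδ)
  refine ⟨min η (δ / 4), lt_min hη (by positivity), fun n n' y y' hy hy' => ?_⟩
  obtain ⟨φ, hφ⟩ := exists_transition hj (le_max_left n n')
  obtain ⟨φ', hφ'⟩ := exists_transition hj (le_max_right n n')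
  obtain ⟨C, hC, ψ, b, hb, hd⟩ := ((h n y fun i => (hy i).trans_le (min_le_left _ _)).congr
    (.refl _) (.of_embedding φ y)).exists_extension hK (hA _)
  have key : ∀ u u', dist (ψ (φ u)) (ψ (φ' u')) = dist (j n u) (j n' u') := fun u u' => by
    rw [ψ.isometry'.dist_eq, ← (hi _).dist_eq, hφ, hφ']
  refine ⟨C, hC, ψ.comp φ, ψ.comp φ', b, hb, fun i => ?_, fun i => ?_, key⟩
  · exact (hd i).trans (half_lt_self hδ)
  · have h1 := (hy i).trans_le (min_le_right _ _)
    have h2 := (hy' i).trans_le (min_le_right _ _)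
    change dist (b i) (ψ (φ' (y' i))) < δ
    linarith [dist_triangle (b i) (ψ (φ (y i))) (ψ (φ' (y' i))), hd i, key (y i) (y' i),
      dist_triangle_left (j n (y i)) (j n' (y' i)) (x i)]

theorem denseRange_chain (hj : ∀ n x, j (n + 1) (e n x) = j n x)
    (hd : Dense (⋃ n, range (j n))) (m : ℕ) :
    DenseRange fun (s : Σ n, Fin m → A n) i => j s.1 (s.2 i) := by
  refine Metric.dense_iff.2 fun x r hr => ?_
  obtain ⟨n, y, hy⟩ := exists_tuple_near hj hd x hr
  refine ⟨_, ?_, ⟨n, y⟩, rfl⟩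
  rw [Metric.mem_ball, dist_pi_lt_iff hr]
  exact fun i => by rw [dist_comm]; exact hy i

/-- The completion of the union of a chain in a Fraïssé class carries a structure. The function
symbols extend although they need not be uniformly continuous, by the continuity property at the
limit types. -/
theorem exists_structure_of_chain [CompleteSpace X] (hK : IsFraisseClass K) (hA : ∀ n, A n ∈ K)
    (hi : ∀ n, Isometry (j n)) (hj : ∀ n x, j (n + 1) (e n x) = j n x)
    (hd : Dense (⋃ n, range (j n))) :
    ∃ (M : MetricStructure.{u, v, w} L) (J : ∀ n, Embedding (A n) M),
      IsStructureOf K M ∧ (∀ n x, J (n + 1) (e n x) = J n x) ∧ Dense (⋃ n, range (J n)) := by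
  have hpred : ∀ (m : ℕ) (R : L.Relations m), ∃ F : (Fin m → X) → ℝ, Continuous F ∧
      ∀ s : Σ n, Fin m → A n, F (fun i => j s.1 (s.2 i)) = (A s.1).pred R s.2 := by
    intro m R
    refine exists_continuous_extension (denseRange_chain hj hd m) _ fun x ε hε => ?_
    obtain ⟨p, hp⟩ := exists_common_extension hK hA hi hj hd x
    obtain ⟨δ, hδ, hR⟩ :=
      hK.exists_dist_pred_lt (hK.hereditary _ p.mem) R p.tuple (half_pos hε)
    obtain ⟨η, hη, h⟩ := hp δ hδ
    refine ⟨η, hη, fun s s' hs hs' => ?_⟩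
    rw [dist_comm, dist_pi_lt_iff hη] at hs hs'
    obtain ⟨C, hC, φ, φ', b, hb, h1, h2, -⟩ := h _ _ s.2 s'.2 hs hs'
    have h3 := hR C (hK.hereditary C hC) b _ hb h1
    have h4 := hR C (hK.hereditary C hC) b _ hb h2
    rw [φ.map_pred'] at h3
    rw [φ'.map_pred'] at h4
    linarith [dist_triangle_left ((A s.1).pred R s.2) ((A s'.1).pred R s'.2) (C.pred R b)]
  have hfunc : ∀ (m : ℕ) (f : L.Functions m), ∃ F : (Fin m → X) → X, Continuous F ∧
      ∀ s : Σ n, Fin m → A n, F (fun i => j s.1 (s.2 i)) = j s.1 ((A s.1).func f s.2) := by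
    intro m f
    refine exists_continuous_extension (denseRange_chain hj hd m) _ fun x ε hε => ?_
    obtain ⟨p, hp⟩ := exists_common_extension hK hA hi hj hd x
    obtain ⟨δ, hδ, hf⟩ :=
      hK.exists_dist_func_lt (hK.hereditary _ p.mem) f p.tuple (half_pos hε)
    obtain ⟨η, hη, h⟩ := hp δ hδ
    refine ⟨η, hη, fun s s' hs hs' => ?_⟩
    rw [dist_comm, dist_pi_lt_iff hη] at hs hs'
    obtain ⟨C, hC, φ, φ', b, hb, h1, h2, h5⟩ := h _ _ s.2 s'.2 hs hs'
    have h3 := hf C (hK.hereditary C hC) b _ hb h1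
    have h4 := hf C (hK.hereditary C hC) b _ hb h2
    rw [φ.map_func'] at h3
    rw [φ'.map_func'] at h4
    rw [← h5]
    linarith [dist_triangle_left (φ ((A s.1).func f s.2)) (φ' ((A s'.1).func f s'.2)) (C.func f b)]
  choose P hPc hP using hpred
  choose F hFc hF using hfunc
  let M : MetricStructure.{u, v, w} L :=
    { carrier := X
      pred := fun {m} R => P m R
      continuous_pred := fun {m} R => hPc m R
      func := fun {m} f => F m f
      continuous_func := fun {m} f => hFc m f }
  let J : ∀ n, Embedding (A n) M := fun n =>
    { toFun := j n
      isometry' := hi n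
      map_pred' := fun {m} R x => hP m R ⟨n, x⟩
      map_func' := fun {m} f x => hF m f ⟨n, x⟩ }
  refine ⟨M, J, ?_, hj, hd⟩
  rintro B ⟨⟨S, hS, hgen⟩, ⟨φ⟩⟩
  obtain ⟨m, x, -, rfl⟩ := hS.fin_param
  obtain ⟨p, hp⟩ := exists_pointed_near hK hA hi hj hd fun i => φ (x i)
  have h1 : SameType p.tuple fun i => φ (x i) :=
    .of_near hK (hK.hereditary _ p.mem) fun δ hδ => by
      obtain ⟨η, hη, h⟩ := hp δ hδ
      obtain ⟨n, y, hy⟩ := exists_tuple_near hj hd (fun i => φ (x i)) (lt_min hη hδ)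
      exact ⟨fun i => J n (y i), fun i => (hy i).trans_le (min_le_right _ _),
        (h n y fun i => (hy i).trans_le (min_le_left _ _)).congr (.refl _) (.of_embedding (J n) y)⟩
  obtain ⟨ψ, -⟩ := ((SameType.of_embedding φ x).trans h1.symm).exists_embedding hgen
  exact hK.hereditary _ p.mem ⟨⟨_, hS, hgen⟩, ⟨ψ⟩⟩

end Chain

theorem exists_directLimit (hK : IsFraisseClass K) {A : ℕ → MetricStructure.{u, v, w} L}
    (hA : ∀ n, A n ∈ K) (e : ∀ n, Embedding (A n) (A (n + 1))) :
    ∃ (M : MetricStructure.{u, v, w} L) (J : ∀ n, Embedding (A n) M),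
      IsStructureOf K M ∧ (∀ n x, J (n + 1) (e n x) = J n x) ∧ Dense (⋃ n, range (J n)) := by
  have I : ∀ n, Isometry (e n) := fun n => (e n).isometry'
  refine exists_structure_of_chain (X := UniformSpace.Completion (Metric.InductiveLimit I))
    (e := e) (j := fun n x => (Metric.toInductiveLimit I n x : UniformSpace.Completion _)) hK hA
    (fun n => UniformSpace.Completion.coe_isometry.comp (Metric.toInductiveLimit_isometry I n))
    (fun n x => congrArg _ (congrFun (Metric.toInductiveLimit_commute I n) x)) ?_
  have := (UniformSpace.Completion.denseRange_coe (α := Metric.InductiveLimit I)).dense_image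
    (UniformSpace.Completion.continuous_coe _) (Metric.dense_iUnion_range_toInductiveLimit I)
  simp only [image_iUnion, ← range_comp] at this
  exact this

/-! ### Structures coded by the elements of the inverse limit -/

theorem exists_isCodedBy (hK : IsFraisseClass K) (ξ : InverseLimit hK.hereditary) :
    ∃ (M : MetricStructure.{u, v, w} L) (a : ℕ → M), IsCodedBy ξ M a := by
  choose p hp using fun n => Quot.exists_rep (ξ.1 n)
  have hs : ∀ n, SameType (p n).tuple fun i : Fin n => (p (n + 1)).tuple i.castSucc := fun n => by
    obtain ⟨q, hq, hq'⟩ := ξ.2 n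
    have h1 : SameType q.tuple (p (n + 1)).tuple :=
      (toQuot_eq_iff hK).1 (hq.trans (hp (n + 1)).symm)
    have h2 := (toQuot_eq_iff hK).1 (hq'.trans (hp n).symm)
    exact (h2.symm.trans (sameType_init hK q)).trans (h1.comp Fin.castSucc)
  choose e he using fun n => (hs n).exists_embedding (p n).generates
  obtain ⟨M, J, hM, hJ, hd⟩ := exists_directLimit hK (fun n => (p n).mem) e
  let a : ℕ → M := fun n => J (n + 1) ((p (n + 1)).tuple (Fin.last n))
  have ha : ∀ n (i : Fin n), J n ((p n).tuple i) = a i := by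
    intro n
    induction n with
    | zero => exact fun i => i.elim0
    | succ n ih =>
      refine Fin.lastCases rfl fun i => ?_
      rw [← he, hJ]
      exact ih i
  refine ⟨M, a, hM, ?_, fun n => ?_⟩
  · refine univ_subset_iff.1 ?_
    rw [← hd.closure_eq]
    refine closure_minimal (iUnion_subset fun n => ?_) (isSubstructure_genSet M _).1
    rintro _ ⟨x, rfl⟩
    refine (J n).map_mem_genSet (S := range (p n).tuple) ?_ ((p n).generates ▸ mem_univ x)
    rintro _ ⟨i, rfl⟩
    rw [ha]
    exact subset_genSet _ _ ⟨_, rfl⟩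
  · rw [← hp n]
    refine (toQuot_eq_iff hK).2 (SameType.trans ?_ (sameType_ofTuple hM _).symm)
    simpa only [ha] using SameType.of_embedding (J n) (p n).tuple

theorem IsCodedBy.sameType (hK : IsFraisseClass K) {ξ : InverseLimit hK.hereditary}
    {M N : MetricStructure.{u, v, w} L} {a : ℕ → M} {b : ℕ → N} (ha : IsCodedBy ξ M a)
    (hb : IsCodedBy ξ N b) : SameType a b := by
  obtain ⟨hM, -, ha⟩ := ha
  obtain ⟨hN, -, hb⟩ := hb
  exact .of_forall_fin fun n => ((sameType_ofTuple hM _).symm.trans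
    ((toQuot_eq_iff hK).1 ((ha n).symm.trans (hb n)))).trans (sameType_ofTuple hN _)

theorem existsUnique_embedding (hK : IsFraisseClass K) {ξ : InverseLimit hK.hereditary}
    {M N : MetricStructure.{u, v, w} L} {a : ℕ → M} {b : ℕ → N} (ha : IsCodedBy ξ M a)
    (hb : IsCodedBy ξ N b) :
    ∃! φ : Embedding M N, Function.Surjective φ ∧ ∀ i, φ (a i) = b i := by
  obtain ⟨φ, hφ⟩ := (ha.sameType hK hb).exists_embedding ha.2.1
  refine ⟨φ, ⟨φ.surjective_of_range hb.2.1 fun i => ⟨a i, hφ i⟩, hφ⟩, fun ψ hψ => ?_⟩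
  refine Embedding.ext (funext fun x => Embedding.eqOn_genSet (S := range a) ?_
    (ha.2.1 ▸ mem_univ x))
  rintro _ ⟨i, rfl⟩
  rw [hφ, hψ.2]

end DirectLimit

/-! ### The extension property of limits -/

section Limit

variable {K : Set (MetricStructure.{u, v, w} L)} {A B C M : MetricStructure.{u, v, w} L}

/-- Any type `q` of an `(n + 1)`-tuple whose first `n` coordinates are near `c` is realized near
`c`, with the same bound. -/
def ExtensionProperty (K : Set (MetricStructure.{u, v, w} L)) (M : MetricStructure.{u, v, w} L) :
    Prop :=
  ∀ (n : ℕ) (c : Fin n → M) (q : Pointed K (n + 1)) (r : ℝ), 0 < r →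
    Near K r c (fun i => q.tuple i.castSucc) →
      ∃ d : M, Near K r (Fin.snoc (α := fun _ => M) c d) q.tuple

theorem ExtensionProperty.exists_tuple (h : ExtensionProperty K M) (hA : IsStructureOf K A)
    {n N : ℕ} (hn : n ≤ N) (q : Fin N → A) (c : Fin n → M) {r : ℝ} (hr : 0 < r)
    (hc : Near K r c fun i => q (Fin.castLE hn i)) :
    ∃ z : Fin N → M, (∀ i, z (Fin.castLE hn i) = c i) ∧ Near K r z q := by
  induction N, hn using Nat.le_induction with
  | base => exact ⟨c, fun _ => rfl, hc⟩
  | succ N hn ih =>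
    obtain ⟨z, hz, hzq⟩ := ih (fun i => q i.castSucc) hc
    obtain ⟨d, hd⟩ := h N z (.ofTuple hA q) r hr
      (hzq.congr (.refl _) ((sameType_ofTuple hA q).symm.comp Fin.castSucc))
    refine ⟨Fin.snoc (α := fun _ => M) z d, fun i => ?_,
      hd.congr (.refl _) (sameType_ofTuple hA q)⟩
    rw [← hz i]
    exact Fin.snoc_castSucc (α := fun _ => M) (x := d) (p := z) (i := Fin.castLE hn i)

theorem strictlyRefines_amalgamApx {X Y Z : Type*} [MetricSpace X] [MetricSpace Y] [MetricSpace Z]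
    {ι κ : Type} [Finite ι] [Finite κ] {a : ι → X} {b : κ → Y} {a' : ι → Z} {b' : κ → Z}
    (ha : ∀ i j, edist (a i) (a j) = edist (a' i) (a' j))
    (hb : ∀ i j, edist (b i) (b j) = edist (b' i) (b' j)) {s : ℝ≥0∞} (hs : 0 < s) :
    StrictlyRefines (amalgamApx a b a' b' ha hb 0) (amalgamApx a b a' b' ha hb s) := by
  refine strictlyRefines_iff.2 ⟨range fun p : ι × κ => (a p.1, b p.2), finite_range _, s, hs,
    fun χ hχ => χ.2.le_amalgamFun fun i j => (hχ _ ⟨(i, j), rfl⟩).trans ?_⟩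
  gcongr
  exact (amalgamFun_le a b a' b' 0 i j).trans_eq (add_zero _)

theorem amalgamApx_mem_stx {ι κ : Type} [Finite ι] [Finite κ] (hC : C ∈ K) {a : ι → A}
    {b : κ → B} {a' : ι → C} {b' : κ → C} (ha : SameType a a') (hb : SameType b b') {s : ℝ≥0∞}
    (hs : 0 < s) : amalgamApx a b a' b' ha.edist_eq hb.edist_eq s ∈ stx K A B :=
  ⟨amalgamApx_mem_apxIso hC ha hb s, _, amalgamApx_mem_apxIso hC ha hb 0,
    strictlyRefines_amalgamApx _ _ hs⟩

theorem IsLimit.extensionProperty (hK : IsFraisseClass K) (hM : IsLimit K M) :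
    ExtensionProperty K M := by
  intro n c q r hr h
  obtain ⟨s, hs, C, hC, c', q', hc, hq, hd⟩ := h.exists_lt
  have hq₀ := hK.hereditary _ q.mem
  obtain ⟨φ, hφ, hφψ, ht⟩ := hM.2.2 q.str hq₀ {q.tuple (Fin.last n)} (finite_singleton _) _
    (amalgamApx_mem_stx hC hq hc (ENNReal.ofReal_pos.2 (half_pos (sub_pos.2 hs)))) (r / 6)
    (by positivity)
  obtain ⟨d, hd'⟩ : ∃ d, φ.1 (q.tuple (Fin.last n)) d < ENNReal.ofReal (r / 2) := by
    have h1 := ht _ rfl _ rfl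
    rw [edist_self, zero_add] at h1
    have h2 : 2 * ENNReal.ofReal (r / 6) < ENNReal.ofReal (r / 2) := by
      rw [← ENNReal.ofReal_ofNat, ← ENNReal.ofReal_mul (by norm_num),
        ENNReal.ofReal_lt_ofReal_iff (by positivity)]
      linarith
    obtain ⟨d, hd⟩ := iInf_lt_iff.1 (h1.trans_lt h2)
    exact ⟨d, le_self_add.trans_lt hd⟩
  obtain ⟨D, hD, x, y, hx, hy, hxy⟩ := exists_amalgam_of_mem_apxIso hK hq₀ hM.2.1 hφ.1 q.tuple
    (Fin.snoc (α := fun _ => M) c d) (lt_min (show 0 < (r - s) / 4 by linarith)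
      (show 0 < r / 4 by positivity))
  refine ⟨d, D, hD, y, x, hy, hx, fun i => ?_⟩
  have h1 := hxy i i
  rw [dist_comm]
  refine Fin.lastCases (fun h1 => ?_) (fun i h1 => ?_) i h1
  · rw [Fin.snoc_last] at h1
    have h2 := h1.trans (add_le_add hd'.le le_rfl)
    rw [← ENNReal.ofReal_add (by positivity) (le_min (by linarith) (by positivity)),
      edist_le_ofReal (add_nonneg (by positivity) (le_min (by linarith) (by positivity)))] at h2
    linarith [min_le_right ((r - s) / 4) (r / 4)]
  · rw [Fin.snoc_castSucc] at h1
    have h2 := h1.trans (add_le_add ((hφψ.le _ _).trans (amalgamFun_le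
      (fun i : Fin n => q.tuple i.castSucc) c q' c' (ENNReal.ofReal ((r - s) / 2)) i i)) le_rfl)
    have h3 : 0 ≤ min ((r - s) / 4) (r / 4) := le_min (by linarith) (by positivity)
    have h4 := dist_nonneg (x := q' i) (y := c' i)
    rw [edist_dist (q' i), ← ENNReal.ofReal_add h4 (by linarith),
      ← ENNReal.ofReal_add (by linarith) h3, edist_le_ofReal (by linarith)] at h2
    linarith [min_le_left ((r - s) / 4) (r / 4), hd i, dist_comm (q' i) (c' i)]

theorem ExtensionProperty.isLimit [TopologicalSpace.SeparableSpace M] (hK : IsFraisseClass K)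
    (hM : IsStructureOf K M) (h : ExtensionProperty K M) : IsLimit K M := by
  refine ⟨inferInstance, hM, fun A hA A₀ hA₀ ψ hψ ε hε => ?_⟩
  obtain ⟨-, ψ₁, hψ₁, hψψ⟩ := hψ
  obtain ⟨F, hF, δ₀, hδ₀, hδψ⟩ := strictlyRefines_iff.1 hψψ
  obtain ⟨δ, hδ, hδδ⟩ : ∃ δ : ℝ, 0 < δ ∧ ENNReal.ofReal δ ≤ δ₀ := by
    obtain ⟨δ, h1, h2⟩ := exists_between hδ₀
    exact ⟨δ.toReal, ENNReal.toReal_pos h1.ne' h2.ne_top, ENNReal.ofReal_toReal_le.trans h2.le⟩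
  obtain ⟨k, x, -, hx⟩ := (hA₀.union (hF.image Prod.fst)).fin_param
  obtain ⟨n, c, -, hc⟩ := (hF.image Prod.snd).fin_param
  obtain ⟨C, hC, x', c', hxx, hcc, hd⟩ := exists_amalgam_of_mem_apxIso hK hA hM hψ₁ x c
    (show 0 < δ / 4 by positivity)
  -- realize in `M`, up to `η`, the type of `(c, x)` over `c`
  obtain ⟨η, hη, hηε, hηδ⟩ : ∃ η : ℝ, 0 < η ∧ η ≤ ε / 2 ∧ η ≤ δ / 4 :=
    ⟨min (ε / 2) (δ / 4), by positivity, min_le_left _ _, min_le_right _ _⟩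
  let q : Fin (n + k) → C := Fin.append c' x'
  have hqc : ∀ i, q (Fin.castLE (n.le_add_right k) i) = c' i := Fin.append_left c' x'
  have hqx : ∀ i, q (Fin.natAdd n i) = x' i := Fin.append_right c' x'
  obtain ⟨z, hz, E, hE, z', q', hzz, hqq, hd'⟩ := h.exists_tuple (hK.hereditary _ hC)
    (n.le_add_right k) q c hη (.of_sameType hM (by simpa only [hqc] using hcc) hη)
  have hxq : SameType x fun i => q' (Fin.natAdd n i) :=
    hxx.trans (by simpa only [hqx] using hqq.comp (Fin.natAdd n))
  have hη' : 0 < ENNReal.ofReal η := ENNReal.ofReal_pos.2 hη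
  have hed : ∀ i, edist (q' i) (z' i) ≤ ENNReal.ofReal η := fun i => by
    rw [edist_dist, dist_comm]; exact ENNReal.ofReal_le_ofReal (hd' i).le
  refine ⟨_, amalgamApx_mem_stx hE hxq hzz hη', strictlyRefines_iff.2 ⟨F, hF,
    ENNReal.ofReal (δ / 4), ENNReal.ofReal_pos.2 (by positivity), fun χ hχ => hδψ χ ?_⟩, ?_⟩
  · rintro ⟨u, v⟩ huv
    obtain ⟨i, rfl⟩ : u ∈ range x := hx ▸ .inr ⟨_, huv, rfl⟩
    obtain ⟨j, rfl⟩ : v ∈ range c := hc ▸ ⟨_, huv, rfl⟩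
    have h1 : edist (q' (Fin.natAdd n i)) (q' (Fin.castLE (n.le_add_right k) j)) ≤
        ψ₁.1 (x i) (c j) + ENNReal.ofReal (δ / 4) := by
      rw [← hqq.edist_eq, hqx, hqc]
      exact hd i j
    have h2 := hχ _ huv
    have h3 := amalgamFun_le x z (fun i => q' (Fin.natAdd n i)) z' (ENNReal.ofReal η) i
      (Fin.castLE (n.le_add_right k) j)
    rw [hz] at h3
    calc χ.1 (x i) (c j) ≤ ψ₁.1 (x i) (c j) + ENNReal.ofReal (δ / 4) + ENNReal.ofReal η +
          ENNReal.ofReal η + ENNReal.ofReal (δ / 4) :=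
        h2.trans (add_le_add (h3.trans (add_le_add ((edist_triangle _ _ _).trans
          (add_le_add h1 (hed _))) le_rfl)) le_rfl)
      _ = ψ₁.1 (x i) (c j) + ENNReal.ofReal (δ / 4 + η + η + δ / 4) := by
        rw [ENNReal.ofReal_add (by positivity) (by positivity),
          ENNReal.ofReal_add (by positivity) (by positivity),
          ENNReal.ofReal_add (by positivity) (by positivity)]
        ring
      _ ≤ ψ₁.1 (x i) (c j) + δ₀ := by
        gcongr
        exact (ENNReal.ofReal_le_ofReal (by linarith)).trans hδδ
  · intro u hu u' _
    obtain ⟨i, rfl⟩ : u ∈ range x := hx ▸ .inl hu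
    set φ := amalgamApx x z (fun i => q' (Fin.natAdd n i)) z' hxq.edist_eq hzz.edist_eq
      (ENNReal.ofReal η)
    have h1 : φ.1 (x i) (z (Fin.natAdd n i)) ≤ ENNReal.ofReal ε := by
      refine (amalgamFun_le _ _ _ _ _ i (Fin.natAdd n i)).trans ?_
      refine (add_le_add (hed _) le_rfl).trans ?_
      rw [← ENNReal.ofReal_add hη.le hη.le]
      exact ENNReal.ofReal_le_ofReal (by linarith)
    refine iInf_le_of_le (z (Fin.natAdd n i)) ?_
    calc φ.1 (x i) (z (Fin.natAdd n i)) + φ.1 u' (z (Fin.natAdd n i))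
        ≤ ENNReal.ofReal ε + (edist u' (x i) + ENNReal.ofReal ε) :=
          add_le_add h1 (((φ.2.2 _ _ _).1).trans (add_le_add le_rfl h1))
      _ = _ := by rw [edist_comm]; ring

end Limit

/-! ### The codes of limits form a dense `Gδ` set -/

section Codes

variable {K : Set (MetricStructure.{u, v, w} L)} {B M : MetricStructure.{u, v, w} L}
  {hK : IsFraisseClass K} {ι : Type} {n : ℕ} {r : ℝ}

/-- The codes of those sequences `a` for which `(a (i k))ₖ` is near the tuple `b`. -/
def codeNear (hK : IsFraisseClass K) (r : ℝ) (i : ι → ℕ) (b : ι → B) :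
    Set (InverseLimit hK.hereditary) :=
  {ξ | ∃ (M : MetricStructure.{u, v, w} L) (a : ℕ → M),
    IsCodedBy ξ M a ∧ Near K r (fun k => a (i k)) b}

theorem mem_codeNear_iff {ξ : InverseLimit hK.hereditary} {a : ℕ → M} (h : IsCodedBy ξ M a)
    {i : ι → ℕ} {b : ι → B} : ξ ∈ codeNear hK r i b ↔ Near K r (fun k => a (i k)) b := by
  refine ⟨?_, fun h' => ⟨M, a, h, h'⟩⟩
  rintro ⟨N, c, hc, h'⟩
  exact h'.congr ((hc.sameType hK h).comp i) (.refl b)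

/-- Being near `b` is an open condition on a code, and involves only one of its coordinates. -/
theorem isOpen_codeNear (hK : IsFraisseClass K) (r : ℝ) (i : Fin n → ℕ) (b : Fin n → B) :
    IsOpen (codeNear hK r i b) := by
  let N := Finset.univ.sup i + 1
  let i' : Fin n → Fin N := fun k => ⟨i k, Nat.lt_succ_of_le (Finset.le_sup (Finset.mem_univ k))⟩
  let V : Set (PointedQuot K N) :=
    {x | ∃ p : Pointed K N, p.toQuot = x ∧ Near K r (fun k => p.tuple (i' k)) b}
  have hV : IsOpen V := by
    refine isOpen_coinduced.2 ?_
    rintro p ⟨q, hq, h⟩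
    replace h := h.congr (((toQuot_eq_iff hK).1 hq).comp i') (.refl b)
    obtain ⟨s, hs, h⟩ := h.exists_lt
    refine ⟨.ofReal (r - s), ENNReal.ofReal_pos.2 (sub_pos.2 hs), fun p' hp' => ⟨p', rfl, ?_⟩⟩
    exact ((((distK_lt_iff hK (sub_pos.2 hs)).1 hp').symm.comp i').trans hK h).mono (by linarith)
  have : codeNear hK r i b = (fun ξ => ξ.1 N) ⁻¹' V := by
    ext ξ
    obtain ⟨M, a, h⟩ := exists_isCodedBy hK ξ
    rw [mem_codeNear_iff h]
    obtain ⟨hM, -, ha⟩ := h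
    have hs : SameType (fun k => (Pointed.ofTuple hM fun l : Fin N => a l).tuple (i' k))
        fun k => a (i k) := (sameType_ofTuple hM fun l : Fin N => a l).comp i'
    constructor
    · exact fun h => ⟨_, (ha N).symm, h.congr hs.symm (.refl b)⟩
    · rintro ⟨p, hp, h⟩
      exact h.congr ((((toQuot_eq_iff hK).1 (hp.trans (ha N))).comp i').trans hs) (.refl b)
  rw [this]
  exact hV.preimage ((continuous_apply N).comp continuous_subtype_val)

theorem apply_snoc {X : Type*} (a : ℕ → X) (i : Fin n → ℕ) (m : ℕ) :
    (fun k => a (Fin.snoc (α := fun _ => ℕ) i m k)) =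
      Fin.snoc (α := fun _ => X) (fun k => a (i k)) (a m) := by
  funext k
  refine Fin.lastCases ?_ (fun k => ?_) k <;> simp

/-- The codes of those sequences `a` which have the extension property for the type `q` over
`(a (i k))ₖ`, with a witness in the tail `(aₘ)_{m ≥ m₀}`. -/
def extensionCodes (hK : IsFraisseClass K) (i : Fin n → ℕ) (q : Pointed K (n + 1)) (r : ℝ)
    (m₀ : ℕ) : Set (InverseLimit hK.hereditary) :=
  (codeNear hK r i fun k => q.tuple k.castSucc)ᶜ ∪
    ⋃ m ≥ m₀, codeNear hK r (Fin.snoc (α := fun _ => ℕ) i m) q.tuple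

theorem mem_extensionCodes_iff {ξ : InverseLimit hK.hereditary} {a : ℕ → M}
    (h : IsCodedBy ξ M a) {i : Fin n → ℕ} {q : Pointed K (n + 1)} {m₀ : ℕ} :
    ξ ∈ extensionCodes hK i q r m₀ ↔ (Near K r (fun k => a (i k)) (fun k => q.tuple k.castSucc) →
      ∃ m ≥ m₀, Near K r (Fin.snoc (α := fun _ => M) (fun k => a (i k)) (a m)) q.tuple) := by
  simp only [extensionCodes, mem_union, mem_compl_iff, mem_codeNear_iff h, mem_iUnion, apply_snoc,
    exists_prop, imp_iff_not_or]

theorem isGδ_extensionCodes (hK : IsFraisseClass K) (i : Fin n → ℕ) (q : Pointed K (n + 1))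
    (r : ℝ) (m₀ : ℕ) : IsGδ (extensionCodes hK i q r m₀) := by
  have := polishSpace_inverseLimit hK
  let _ := TopologicalSpace.upgradeIsCompletelyMetrizable (InverseLimit hK.hereditary)
  exact (isOpen_codeNear hK r i _).isClosed_compl.isGδ.union
    (isOpen_biUnion fun m _ => isOpen_codeNear hK r _ _).isGδ

/-- The code of a sequence in a structure of the class. -/
def codeOf (hK : IsFraisseClass K) (hM : IsStructureOf K M) (a : ℕ → M) :
    InverseLimit hK.hereditary :=
  ⟨fun n => (Pointed.ofTuple hM fun i : Fin n => a i).toQuot, fun n =>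
    ⟨_, rfl, (toQuot_eq_iff hK).2 (((sameType_init hK _).trans
      ((sameType_ofTuple hM fun i : Fin (n + 1) => a i).comp Fin.castSucc)).trans
        (sameType_ofTuple hM fun i : Fin n => a i).symm)⟩⟩

/-- Near any code there is, by amalgamation, one that realizes the type `q` at a late stage. -/
theorem dense_extensionCodes (hK : IsFraisseClass K) (i : Fin n → ℕ) (q : Pointed K (n + 1))
    {r : ℝ} (hr : 0 < r) (m₀ : ℕ) : Dense (extensionCodes hK i q r m₀) := by
  intro ξ
  by_cases hξ : ξ ∈ extensionCodes hK i q r m₀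
  · exact subset_closure hξ
  obtain ⟨M, a, h⟩ := exists_isCodedBy hK ξ
  rw [mem_extensionCodes_iff h, Classical.not_imp] at hξ
  obtain ⟨hM, -, ha⟩ := h
  refine mem_closure_iff.2 fun U hU hξU => ?_
  -- the codes agreeing with `ξ` up to some stage are in `U`
  obtain ⟨N₀, hN₀⟩ : ∃ N₀, ∀ ζ : InverseLimit hK.hereditary,
      (∀ k ≤ N₀, ζ.1 k = ξ.1 k) → ζ ∈ U := by
    have h1 : U ∈ 𝓝 ξ := hU.mem_nhds hξU
    rw [nhds_subtype_eq_comap, mem_comap] at h1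
    obtain ⟨S, hS, hSU⟩ := h1
    rw [nhds_pi, Filter.mem_pi'] at hS
    obtain ⟨I, t, ht, hIt⟩ := hS
    refine ⟨I.sup id, fun ζ hζ => hSU (hIt fun k hk => ?_)⟩
    rw [hζ k (Finset.le_sup (f := id) hk)]
    exact mem_of_mem_nhds (ht k)
  let N := max (max N₀ m₀) (Finset.univ.sup i + 1)
  have hN : ∀ k, i k < N := fun k =>
    (Nat.lt_succ_of_le (Finset.le_sup (Finset.mem_univ k))).trans_le (le_max_right _ _)
  obtain ⟨s, hs, h⟩ := hξ.1.exists_lt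
  obtain ⟨C, hC, e, b, hb, hd⟩ := h.exists_extension hK q.mem
    (y := fun k : Fin n => q.tuple k.castSucc)
  let g := genTuple fun k : Fin N => a k
  have hg : SameType g fun k : Fin N => a k := sameType_genTuple _
  obtain ⟨D, hD, gC, gA, hd'⟩ := hK.amalgamate hC (hM.generated_mem fun k : Fin N => a k)
    (hb.symm.trans (hg.comp fun k => (⟨i k, hN k⟩ : Fin N)).symm) (sub_pos.2 hs)
  -- the initial segment of `a` of length `N`, followed by copies of the last entry of `q`
  let c : ℕ → D := fun k => if hk : k < N then gA (g ⟨k, hk⟩) else gC (e (q.tuple (Fin.last n)))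
  have hM' : IsStructureOf K (generated D (range c)) :=
    (hK.hereditary D hD).of_embedding (generatedInclusion D (range c))
  have hc : SameType (genTuple c) c := sameType_genTuple c
  have hζ : IsCodedBy (codeOf hK hM' (genTuple c)) (generated D (range c)) (genTuple c) :=
    ⟨hM', genSet_genTuple c, fun _ => rfl⟩
  refine ⟨codeOf hK hM' (genTuple c), hN₀ _ fun k hk => ?_, (mem_extensionCodes_iff hζ).2 fun _ =>
    ⟨N, (le_max_right _ _).trans (le_max_left _ _), ?_⟩⟩
  · have hkN : k ≤ N := hk.trans ((le_max_left _ _).trans (le_max_left _ _))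
    rw [ha]
    refine (toQuot_eq_iff hK).2 ((sameType_ofTuple hM' _).trans (SameType.trans ?_
      (sameType_ofTuple hM _).symm))
    have h1 : (fun l : Fin k => c l) = fun l : Fin k => gA (g (Fin.castLE hkN l)) := by
      funext l
      exact dif_pos (l.2.trans_le hkN)
    have h2 := hc.comp fun l : Fin k => (l : ℕ)
    rw [h1] at h2
    exact (h2.trans (SameType.of_embedding gA _).symm).trans (hg.comp (Fin.castLE hkN))
  · have h1 : Near K r (Fin.snoc (α := fun _ => D) (fun k => c (i k)) (c N))
        fun k => gC (e (q.tuple k)) := by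
      refine .of_dist_lt (hK.hereditary D hD) fun k => ?_
      refine Fin.lastCases ?_ (fun k => ?_) k
      · simpa [c] using hr
      · have h2 : c (i k) = gA (g ⟨i k, hN k⟩) := dif_pos (hN k)
        rw [Fin.snoc_castSucc, h2]
        have h3 := gC.isometry'.dist_eq (b k) (e (q.tuple k.castSucc))
        linarith [hd k, hd' k, dist_triangle_left (gA (g ⟨i k, hN k⟩))
          (gC (e (q.tuple k.castSucc))) (gC (b k))]
    refine h1.congr ?_ (SameType.of_embedding (gC.comp e) q.tuple).symm
    simpa only [apply_snoc] using hc.symm.comp (Fin.snoc (α := fun _ => ℕ) i N)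

section Generic

variable {ξ : InverseLimit hK.hereditary} {a : ℕ → M}

/-- If the extension property holds along the sequence `a` for a dense set of types and rational
bounds, with witnesses in every tail, then it holds along `a` for all types and bounds. -/
theorem exists_near_snoc (hK : IsFraisseClass K) {Q : Set (Pointed K (n + 1))}
    (hQ : ∀ (p : Pointed K (n + 1)) (ε : ℝ≥0∞), 0 < ε → ∃ q ∈ Q, distK p q < ε) {i : Fin n → ℕ}
    {m₀ : ℕ} (h : ∀ q ∈ Q, ∀ ρ : ℚ, 0 < ρ →
      Near K ρ (fun k => a (i k)) (fun k => q.tuple k.castSucc) →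
      ∃ m ≥ m₀, Near K ρ (Fin.snoc (α := fun _ => M) (fun k => a (i k)) (a m)) q.tuple)
    {p : Pointed K (n + 1)} (hr : 0 < r)
    (hp : Near K r (fun k => a (i k)) fun k => p.tuple k.castSucc) :
    ∃ m ≥ m₀, Near K r (Fin.snoc (α := fun _ => M) (fun k => a (i k)) (a m)) p.tuple := by
  obtain ⟨s, hs, hp⟩ : ∃ s < r, Near K s (fun k => a (i k)) fun k => p.tuple k.castSucc :=
    hp.exists_lt
  obtain ⟨t, ht, htr, hst⟩ : ∃ t, 0 < t ∧ t < r ∧ s ≤ t :=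
    ⟨max s (r / 2), by positivity, max_lt hs (by linarith), le_max_left _ _⟩
  have hη : 0 < (r - t) / 3 := by linarith
  obtain ⟨q, hq, hpq⟩ := hQ p _ (ENNReal.ofReal_pos.2 hη)
  have hpq' := (distK_lt_iff hK hη).1 hpq
  obtain ⟨ρ, hρ, hρ'⟩ := exists_rat_btwn (show t + (r - t) / 3 < t + 2 * ((r - t) / 3) by linarith)
  obtain ⟨m, hm, hmq⟩ := h q hq ρ (by exact_mod_cast (show (0 : ℝ) < ρ by linarith))
    ((hp.trans hK (hpq'.comp Fin.castSucc)).mono (by linarith))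
  exact ⟨m, hm, (hmq.trans hK hpq'.symm).mono (by linarith)⟩

/-- A sequence with the extension property, with witnesses in every tail, has dense tails. Indeed
the extension property yields elements `aₘ` such that the type of `(a, aₘ)` approaches that of
`(a, t(a))`, for any term `t`, and by the continuity property these `aₘ` approach `t(a)`. -/
theorem dense_image_Ici (hK : IsFraisseClass K) (hM : IsStructureOf K M)
    (hgen : genSet M (range a) = univ)
    (h : ∀ (n : ℕ) (i : Fin n → ℕ) (q : Pointed K (n + 1)) (r : ℝ) (m₀ : ℕ), 0 < r →
      Near K r (fun k => a (i k)) (fun k => q.tuple k.castSucc) →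
      ∃ m ≥ m₀, Near K r (Fin.snoc (α := fun _ => M) (fun k => a (i k)) (a m)) q.tuple) (m₀ : ℕ) :
    Dense (a '' Ici m₀) := by
  have key : ∀ (n : ℕ) (t : L.Term (Fin n)),
      realize (fun k : Fin n => a k) t ∈ closure (a '' Ici m₀) := by
    intro n t
    refine Metric.mem_closure_iff.2 fun ε hε => ?_
    let α : Fin n → M := fun k => a k
    obtain ⟨δ, hδ, ht⟩ := hK.exists_dist_realize_lt hM t α (half_pos hε)
    let q : Pointed K (n + 1) := .ofTuple hM (Fin.snoc (α := fun _ => M) α (realize α t))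
    have hq : SameType q.tuple (Fin.snoc (α := fun _ => M) α (realize α t)) := sameType_ofTuple _ _
    have hqα : SameType (fun k : Fin n => q.tuple k.castSucc) α := by
      simpa using hq.comp Fin.castSucc
    obtain ⟨m, hm, C, hC, x, y, hx, hy, hxy⟩ := h n (fun k => k) q (min δ (ε / 2)) m₀
      (lt_min hδ (half_pos hε)) (.of_sameType hM hqα.symm (lt_min hδ (half_pos hε)))
    refine ⟨a m, ⟨m, hm, rfl⟩, ?_⟩
    -- in `C`, the tuple `x` is a copy of `(a, aₘ)` and the nearby tuple `y` one of `(a, t(a))`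
    let τ : L.Term (Fin (n + 1)) := t.subst fun k => .var k.castSucc
    have hτ : ∀ {B : MetricStructure.{u, v, w} L} (b : Fin (n + 1) → B),
        realize b τ = realize (fun k : Fin n => b k.castSucc) t := fun b => realize_subst _ _ _
    have e1 : y (Fin.last n) = realize (fun k : Fin n => y k.castSucc) t := by
      have := (hq.symm.trans hy).dist_realize (.var (Fin.last n)) τ
      rw [hτ, hτ] at this
      simpa [realize, eq_comm] using this
    have e2 : dist (realize α t) (a m) =
        dist (realize (fun k : Fin n => x k.castSucc) t) (x (Fin.last n)) := by
      have := hx.dist_realize τ (.var (Fin.last n))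
      rw [hτ, hτ] at this
      simpa [realize] using this
    have h1 := ht C (hK.hereditary C hC) (fun k => y k.castSucc) (fun k => x k.castSucc)
      (hqα.symm.trans (hy.comp Fin.castSucc)) fun k => by
        rw [dist_comm]; exact (hxy _).trans_le (min_le_left _ _)
    rw [e2]
    have h2 := (hxy (Fin.last n)).trans_le (min_le_right _ _)
    rw [e1] at h2
    linarith [dist_triangle_right (realize (fun k : Fin n => x k.castSucc) t) (x (Fin.last n))
      (realize (fun k : Fin n => y k.castSucc) t),
      dist_comm (realize (fun k : Fin n => x k.castSucc) t)
        (realize (fun k : Fin n => y k.castSucc) t)]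
  have hd : Dense (range (realize a)) := denseRange_realize hgen
  refine dense_closure.1 (hd.mono ?_)
  rintro _ ⟨t, rfl⟩
  obtain ⟨N, hN⟩ := exists_term_fin.{u, v, w} t
  obtain ⟨t', ht'⟩ := hN N le_rfl
  rw [ht']
  exact key N t'

theorem extensionProperty_of_dense (hK : IsFraisseClass K) (hM : IsStructureOf K M)
    (hd : Dense (range a))
    (h : ∀ (n : ℕ) (i : Fin n → ℕ) (q : Pointed K (n + 1)) (r : ℝ) (m₀ : ℕ), 0 < r →
      Near K r (fun k => a (i k)) (fun k => q.tuple k.castSucc) →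
      ∃ m ≥ m₀, Near K r (Fin.snoc (α := fun _ => M) (fun k => a (i k)) (a m)) q.tuple) :
    ExtensionProperty K M := by
  intro n c q r hr hc
  obtain ⟨s, hs, hc⟩ := hc.exists_lt
  obtain ⟨t, ht, htr, hst⟩ : ∃ t, 0 < t ∧ t < r ∧ s ≤ t :=
    ⟨max s (r / 2), by positivity, max_lt hs (by linarith), le_max_left _ _⟩
  have hη : 0 < (r - t) / 2 := by linarith
  have hi : ∀ k, ∃ i, dist (c k) (a i) < (r - t) / 2 := fun k => by
    obtain ⟨_, ⟨i, rfl⟩, hi⟩ := hd.exists_dist_lt (c k) hη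
    exact ⟨i, hi⟩
  choose i hi using hi
  obtain ⟨m, -, hm⟩ := h n i q (t + (r - t) / 2) 0 (by linarith)
    (((Near.of_dist_lt hM hi).symm.trans hK hc).mono (by linarith))
  have h1 : Near K ((r - t) / 2) (Fin.snoc (α := fun _ => M) c (a m))
      (Fin.snoc (α := fun _ => M) (fun k => a (i k)) (a m)) :=
    .of_dist_lt hM fun k => by
      refine Fin.lastCases ?_ (fun k => ?_) k
      · simpa using hη
      · simpa using hi k
  exact ⟨a m, (h1.trans hK hm).mono (by linarith)⟩

end Generic

/-- The codes of limits, enumerated with dense tails, are characterized by countably many instances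
of the extension property. -/
theorem limitCodes_eq_iInter (hK : IsFraisseClass K) (Q : ∀ n, Set (Pointed K (n + 1)))
    (hQ : ∀ n (p : Pointed K (n + 1)) (ε : ℝ≥0∞), 0 < ε → ∃ q ∈ Q n, distK p q < ε) :
    limitCodes hK.hereditary =
      ⋂ t : Σ n, (Fin n → ℕ) × Q n × {ρ : ℚ // 0 < ρ} × ℕ,
        extensionCodes hK t.2.1 t.2.2.1.1 t.2.2.2.1.1 t.2.2.2.2 := by
  ext ξ
  rw [mem_iInter]
  constructor
  · rintro ⟨M, a, h, hM, hd⟩ ⟨n, i, q, ρ, m₀⟩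
    refine (mem_extensionCodes_iff h).2 fun hq => ?_
    have hρ : (0 : ℝ) < (ρ : ℚ) := by exact_mod_cast ρ.2
    obtain ⟨d, hd'⟩ := hM.extensionProperty hK n _ q.1 _ hρ hq
    obtain ⟨s, hs, hd'⟩ := hd'.exists_lt
    obtain ⟨_, ⟨m, hm, rfl⟩, hdm⟩ := (hd m₀).exists_dist_lt d (sub_pos.2 hs)
    have h1 : Near K ((ρ : ℚ) - s) (Fin.snoc (α := fun _ => M) (fun k => a (i k)) (a m))
        (Fin.snoc (α := fun _ => M) (fun k => a (i k)) d) :=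
      .of_dist_lt hM.2.1 fun k => by
        refine Fin.lastCases ?_ (fun k => ?_) k
        · simpa [dist_comm] using hdm
        · simpa using hs
    exact ⟨m, hm, (h1.trans hK hd').mono (by linarith)⟩
  · intro h
    obtain ⟨M, a, ha⟩ := exists_isCodedBy hK ξ
    have hM := ha.1
    have key : ∀ (n : ℕ) (i : Fin n → ℕ) (q : Pointed K (n + 1)) (r : ℝ) (m₀ : ℕ), 0 < r →
        Near K r (fun k => a (i k)) (fun k => q.tuple k.castSucc) →
        ∃ m ≥ m₀, Near K r (Fin.snoc (α := fun _ => M) (fun k => a (i k)) (a m)) q.tuple :=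
      fun n i q r m₀ hr => exists_near_snoc hK (hQ n) (fun q hq ρ hρ =>
        (mem_extensionCodes_iff ha).1 (h ⟨n, i, ⟨q, hq⟩, ⟨ρ, hρ⟩, m₀⟩)) hr
    have hd := dense_image_Ici hK hM ha.2.1 key
    have : TopologicalSpace.SeparableSpace M := ⟨_, (Ici 0).to_countable.image a, hd 0⟩
    exact ⟨M, a, ha, (extensionProperty_of_dense hK hM ((hd 0).mono (image_subset_range _ _))
      key).isLimit hK hM, hd⟩

theorem isGδ_dense_limitCodes (hK : IsFraisseClass K) :
    IsGδ (limitCodes hK.hereditary) ∧ Dense (limitCodes hK.hereditary) := by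
  choose Q hQc hQ using fun n => hK.separable (n + 1)
  have := fun n => (hQc n).to_subtype
  have := polishSpace_inverseLimit hK
  let _ := TopologicalSpace.upgradeIsCompletelyMetrizable (InverseLimit hK.hereditary)
  rw [limitCodes_eq_iInter hK Q hQ]
  exact ⟨.iInter fun t => isGδ_extensionCodes hK _ _ _ _,
    dense_iInter_of_Gδ (fun t => isGδ_extensionCodes hK _ _ _ _) fun t =>
      dense_extensionCodes hK _ _ (by exact_mod_cast t.2.2.2.1.2) _⟩

end Codes

end MetricFraisse

theorem mainTheorem5 {L : FirstOrder.Language.{u, v}}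
    (K : Set (MetricFraisse.MetricStructure.{u, v, w} L))
    (hK : MetricFraisse.IsFraisseClass K) :
    -- every code has an associated structure with a generating sequence,
    (∀ ξ : MetricFraisse.InverseLimit hK.hereditary,
      ∃ (M : MetricFraisse.MetricStructure.{u, v, w} L) (a : ℕ → M),
        MetricFraisse.IsCodedBy ξ M a) ∧
    -- which is determined up to a unique isomorphism;
    (∀ (ξ : MetricFraisse.InverseLimit hK.hereditary)
      (M N : MetricFraisse.MetricStructure.{u, v, w} L) (a : ℕ → M) (b : ℕ → N),
        MetricFraisse.IsCodedBy ξ M a → MetricFraisse.IsCodedBy ξ N b →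
          ∃! φ : MetricFraisse.Embedding M N, Function.Surjective φ ∧ ∀ i, φ (a i) = b i) ∧
    PolishSpace (MetricFraisse.InverseLimit hK.hereditary) ∧
    IsGδ (MetricFraisse.limitCodes hK.hereditary) ∧
    Dense (MetricFraisse.limitCodes hK.hereditary) := by
  exact ⟨MetricFraisse.exists_isCodedBy hK,
    fun _ _ _ _ _ ha hb => MetricFraisse.existsUnique_embedding hK ha hb,
    MetricFraisse.polishSpace_inverseLimit hK, MetricFraisse.isGδ_dense_limitCodes hK⟩
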